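/- Let $\Bbbk$ be a field of characteristic $0$, $R$ a finite-dimensional semisimple $\Bbbk$-algebra, and $A$ a unital associative $\Bbbk$-algebra with a unital embedding $R\hookrightarrow A$. Let $\Omega^\bullet_RA=T_A(\Omega^1_RA)$ be the algebra of noncommutative differential forms relative to $R$, with differential $d$, and let $\mathrm{DR}^\bullet_RA=\Omega^\bullet_RA/[\Omega^\bullet_RA,\Omega^\bullet_RA]_{\mathrm{super}}$ be the Karoubi–de Rham complex. For an $A$-bimodule $M$ put $M_\natural=M/[A,M]$; thus $\mathrm{DR}^1_RA=(\Omega^1_RA)_\natural$. Let $\mathrm{Der}_R(A)$ be the Lie algebra of $\Bbbk$-linear derivations $A\to A$ that vanish on $R$, and let $\mathrm{Inn}_R(A)\subset\mathrm{Der}_R(A)$ be the Lie ideal of the derivations $a\mapsto am-ma$ with $m\in A$ commuting with $R$. (For an algebra $B$ with a unital homomorphism $R\to B$, not necessarily injective, $\mathrm{Der}_R(B)$ and $\mathrm{Inn}_R(B)$ are defined in the same way.) Let $\mathbb{D}\mathrm{er}_RA$ be the space of derivations $\Theta:A\to A\otimes A$, $\Theta(a)=\Theta'(a)\otimes\Theta''(a)$,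 that vanish on $R$, for the outer bimodule structure $b(x\otimes y)c=bx\otimes yc$; it is an $A$-bimodule through the inner structure $b(x\otimes y)c=xc\otimes by$. For $\Theta\in\mathbb{D}\mathrm{er}_RA$ let $i_\Theta:\Omega^\bullet_RA\to\Omega^\bullet_RA\otimes\Omega^\bullet_RA$ be the superderivation with $i_\Theta(a)=0$ and $i_\Theta(da)=\Theta(a)$, and let $\imath_\Theta\alpha=(i_\Theta\alpha)^\diamond$, where $(\alpha\otimes\beta)^\diamond=(-1)^{mn}\beta\alpha$ for $\alpha\in\Omega^m_RA$, $\beta\in\Omega^n_RA$. The map $\imath_\Theta$ descends to a map $\mathrm{DR}^\bullet_RA\to\Omega^{\bullet-1}_RA$. Let $\omega\in\mathrm{DR}^2_RA$ be bi-symplectic, i.e. $d\omega=0$ in $\mathrm{DR}^3_RA$ and $\imath(\omega):\mathbb{D}\mathrm{er}_RA\to\Omega^1_RA$, $\Theta\mapsto\imath_\Theta\omega$, is a bijection (hence an isomorphism of bimodules). Let $\mathsf{H}_\omega:\mathrm{DR}^1_RA\to\mathrm{Der}_R(A)$ be the composite of the inverse of the induced bijection $\imath(\omega)_\natural:(\mathbb{D}\mathrm{er}_RA)_\natural\to\mathrm{DR}^1_RA$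 with the map $(\mathbb{D}\mathrm{er}_RA)_\natural\to\mathrm{Der}_R(A)$ induced by $\Theta\mapsto\big(a\mapsto\Theta'(a)\Theta''(a)\big)$. For $p\in A_\natural=A/[A,A]$ put $\theta_p=\mathsf{H}_\omega(dp)$ and $\{p,q\}=\theta_p(q)\bmod[A,A]$. Let $\mathbf e=\mathbf e'\otimes\mathbf e''\in R\otimes R$ be the symmetric separability element ($r\mathbf e=\mathbf e r$ for $r\in R$, $\mathbf e'\mathbf e''=1$, $\mathbf e''\otimes\mathbf e'=\mathbf e$), let $\Delta\in\mathbb{D}\mathrm{er}_RA$ be $\Delta(a)=a\mathbf e'\otimes\mathbf e''-\mathbf e'\otimes\mathbf e''a$, and let $\mathbf w\in A$ be a moment element of $\omega$, i.e. $d\mathbf w=\imath_\Delta\omega$ in $\Omega^1_RA$. Put $A_{\mathbf w}=A/A\mathbf wA$, with the induced map $R\to A_{\mathbf w}$. Then $\{-,-\}$ is a Lie bracket on $A_\natural$, and: (i) For every $p\in A_\natural$ the derivation $\theta_p$ preserves the ideal $A\mathbf wA$, hence induces a well-defined derivation $\bar\theta_p\in\mathrm{Der}_R(A_{\mathbf w})$,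 which depends linearly on $p$. (ii) The Lie bracket on $A_\natural$ descends along the projection $A_\natural\twoheadrightarrow(A_{\mathbf w})_\natural$ to a well-defined Lie bracket on $(A_{\mathbf w})_\natural$. (iii) There is a homomorphism of Lie algebras $\bar\varphi:(A_{\mathbf w})_\natural\to\mathrm{Der}_R(A_{\mathbf w})/\mathrm{Inn}_R(A_{\mathbf w})$ such that, for every $p\in A_\natural$, $\bar\varphi$ maps the image of $p$ in $(A_{\mathbf w})_\natural$ to the class of $\bar\theta_p$. -/

import Mathlib

open scoped TensorProduct

noncomputable section

namespace NCSymp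

universe uk uR uA uB

variable {k : Type uk} {R : Type uR} {A : Type uA} {B : Type uB}
variable [Field k] [Ring R] [Algebra k R] [Ring A] [Algebra k A] [Ring B] [Algebra k B]

/-! ### Noncommutative relative differential forms -/

/-- The relations defining the algebra of relative differential forms.  The generator `Sum.inl a`
stands for `a`, the generator `Sum.inr a` stands for the symbol `da`. -/
inductive FormRel (i : R →ₐ[k] A) : FreeAlgebra k (A ⊕ A) → FreeAlgebra k (A ⊕ A) → Prop
  | add (a b : A) : FormRel i (FreeAlgebra.ι k (Sum.inl (a + b)))
      (FreeAlgebra.ι k (Sum.inl a) + FreeAlgebra.ι k (Sum.inl b))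
  | smul (c : k) (a : A) : FormRel i (FreeAlgebra.ι k (Sum.inl (c • a)))
      (c • FreeAlgebra.ι k (Sum.inl a))
  | one : FormRel i (FreeAlgebra.ι k (Sum.inl 1)) 1
  | mul (a b : A) : FormRel i (FreeAlgebra.ι k (Sum.inl (a * b)))
      (FreeAlgebra.ι k (Sum.inl a) * FreeAlgebra.ι k (Sum.inl b))
  | d_add (a b : A) : FormRel i (FreeAlgebra.ι k (Sum.inr (a + b)))
      (FreeAlgebra.ι k (Sum.inr a) + FreeAlgebra.ι k (Sum.inr b))
  | d_smul (c : k) (a : A) : FormRel i (FreeAlgebra.ι k (Sum.inr (c • a)))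
      (c • FreeAlgebra.ι k (Sum.inr a))
  | d_mul (a b : A) : FormRel i (FreeAlgebra.ι k (Sum.inr (a * b)))
      (FreeAlgebra.ι k (Sum.inr a) * FreeAlgebra.ι k (Sum.inl b) +
        FreeAlgebra.ι k (Sum.inl a) * FreeAlgebra.ι k (Sum.inr b))
  | d_base (r : R) : FormRel i (FreeAlgebra.ι k (Sum.inr (i r))) 0

/-- The algebra `Ω_R A` of noncommutative differential forms on `A` relative to `R`: the universal
`k`-algebra that receives an algebra map from `A` and a derivation `d` out of `A` with `d(R) = 0`.
Since `Ω¹_R A` is the bimodule that represents `Der_R(A, -)`, this is the tensor algebra over `A`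
of the bimodule `Ω¹_R A` (the two have the same universal property, see `Omega.lift`). -/
def Omega (i : R →ₐ[k] A) : Type (max uk uA) := RingQuot (FormRel i)

instance (i : R →ₐ[k] A) : Ring (Omega i) := inferInstanceAs (Ring (RingQuot (FormRel i)))

instance (i : R →ₐ[k] A) : Algebra k (Omega i) :=
  inferInstanceAs (Algebra k (RingQuot (FormRel i)))

/-- The quotient map from the free algebra. -/
def Omega.mk (i : R →ₐ[k] A) : FreeAlgebra k (A ⊕ A) →ₐ[k] Omega i :=
  RingQuot.mkAlgHom k (FormRel i)

lemma Omega.mk_rel {i : R →ₐ[k] A} {x y : FreeAlgebra k (A ⊕ A)} (h : FormRel i x y) :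
    Omega.mk i x = Omega.mk i y := RingQuot.mkAlgHom_rel k h

/-- The degree zero part `A → Ω_R A`. -/
def incl (i : R →ₐ[k] A) : A →ₐ[k] Omega i :=
  AlgHom.ofLinearMap
    { toFun := fun a => Omega.mk i (FreeAlgebra.ι k (Sum.inl a))
      map_add' := fun a b => by
        rw [Omega.mk_rel (FormRel.add a b), map_add]
      map_smul' := fun c a => by
        rw [Omega.mk_rel (FormRel.smul c a), map_smul, RingHom.id_apply] }
    (by
      change Omega.mk i _ = 1
      rw [Omega.mk_rel FormRel.one, map_one])
    (fun a b => by
      change Omega.mk i _ = Omega.mk i _ *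
        Omega.mk i _
      rw [Omega.mk_rel (FormRel.mul a b), map_mul])

/-- The universal derivation `a ↦ da`. -/
def dgen (i : R →ₐ[k] A) : A →ₗ[k] Omega i where
  toFun a := Omega.mk i (FreeAlgebra.ι k (Sum.inr a))
  map_add' a b := by rw [Omega.mk_rel (FormRel.d_add a b), map_add]
  map_smul' c a := by
    rw [Omega.mk_rel (FormRel.d_smul c a), map_smul, RingHom.id_apply]

lemma dgen_mul (i : R →ₐ[k] A) (a b : A) :
    dgen i (a * b) = dgen i a * incl i b + incl i a * dgen i b := by
  change Omega.mk i _ = Omega.mk i _ *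
    Omega.mk i _ + Omega.mk i _ *
    Omega.mk i _
  rw [Omega.mk_rel (FormRel.d_mul a b), map_add, map_mul, map_mul]

lemma dgen_base (i : R →ₐ[k] A) (r : R) : dgen i (i r) = 0 := by
  change Omega.mk i _ = 0
  rw [Omega.mk_rel (FormRel.d_base r), map_zero]

/-- The universal property of `Ω_R A`. -/
def Omega.lift (i : R →ₐ[k] A) (f : A →ₐ[k] B) (δ : A →ₗ[k] B)
    (hmul : ∀ a b, δ (a * b) = δ a * f b + f a * δ b) (hbase : ∀ r, δ (i r) = 0) :
    Omega i →ₐ[k] B :=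
  RingQuot.liftAlgHom k ⟨FreeAlgebra.lift k (Sum.elim f δ), by
    intro x y h
    cases h <;> simp [hmul, hbase]⟩

@[simp] lemma Omega.lift_incl (i : R →ₐ[k] A) (f : A →ₐ[k] B) (δ : A →ₗ[k] B)
    (hmul : ∀ a b, δ (a * b) = δ a * f b + f a * δ b) (hbase : ∀ r, δ (i r) = 0) (a : A) :
    Omega.lift i f δ hmul hbase (incl i a) = f a := by
  refine (RingQuot.liftAlgHom_mkAlgHom_apply k _ _ _).trans ?_
  simp

@[simp] lemma Omega.lift_dgen (i : R →ₐ[k] A) (f : A →ₐ[k] B) (δ : A →ₗ[k] B)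
    (hmul : ∀ a b, δ (a * b) = δ a * f b + f a * δ b) (hbase : ∀ r, δ (i r) = 0) (a : A) :
    Omega.lift i f δ hmul hbase (dgen i a) = δ a := by
  refine (RingQuot.liftAlgHom_mkAlgHom_apply k _ _ _).trans ?_
  simp

lemma Omega.induction (i : R →ₐ[k] A) {C : Omega i → Prop}
    (hs : ∀ c : k, C (algebraMap k _ c)) (h0 : ∀ a, C (incl i a)) (h1 : ∀ a, C (dgen i a))
    (hadd : ∀ x y, C x → C y → C (x + y)) (hmul : ∀ x y, C x → C y → C (x * y))
    (x : Omega i) : C x := by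
  obtain ⟨y, rfl⟩ : ∃ y, Omega.mk i y = x := RingQuot.mkAlgHom_surjective k (FormRel i) x
  induction y using FreeAlgebra.induction with
  | grade0 c => rw [AlgHom.commutes]; exact hs c
  | grade1 a =>
    cases a with
    | inl a => exact h0 a
    | inr a => exact h1 a
  | mul a b ha hb => rw [map_mul]; exact hmul _ _ ha hb
  | add a b ha hb => rw [map_add]; exact hadd _ _ ha hb

/-- `Ω^n_R A`, the span of the forms `a₀ da₁ ⋯ daₙ` (a product of submodules is the span of the
products of their elements). -/
def Omega.deg (i : R →ₐ[k] A) (n : ℕ) : Submodule k (Omega i) :=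
  LinearMap.range (incl i).toLinearMap * LinearMap.range (dgen i) ^ n

/-! ### Twisted derivations of the algebra of forms -/

lemma mat_ext {C : Type*} {M N : Matrix (Fin 2) (Fin 2) C} (h₀₀ : M 0 0 = N 0 0) (h₀₁ : M 0 1 = N 0 1)
    (h₁₀ : M 1 0 = N 1 0) (h₁₁ : M 1 1 = N 1 1) : M = N :=
  Matrix.ext (Fin.forall_fin_two.2 ⟨Fin.forall_fin_two.2 ⟨h₀₀, h₀₁⟩, Fin.forall_fin_two.2 ⟨h₁₀, h₁₁⟩⟩)

/-- The linear map `a ↦ (p a, q a; 0, s a)`. -/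
def upper (p q s : A →ₗ[k] B) : A →ₗ[k] Matrix (Fin 2) (Fin 2) B where
  toFun a := !![p a, q a; 0, s a]
  map_add' a b := mat_ext (map_add p a b) (map_add q a b) (add_zero 0).symm (map_add s a b)
  map_smul' c a := mat_ext (map_smul p c a) (map_smul q c a) (smul_zero c).symm (map_smul s c a)

lemma upper_apply (p q s : A →ₗ[k] B) (a : A) : upper p q s a = !![p a, q a; 0, s a] := rfl

lemma upper_mul (p q s p' q' s' : B) :
    !![p, q; 0, s] * !![p', q'; 0, s'] = !![p * p', q * s' + p * q'; 0, s * s'] := by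
  rw [Matrix.mul_fin_two]
  simp only [mul_zero, zero_mul, add_zero, zero_add, add_comm (p * q')]

lemma upper_add (p q s p' q' s' : B) :
    !![p, q; 0, s] + !![p', q'; 0, s'] = !![p + p', q + q'; 0, s + s'] :=
  mat_ext rfl rfl (add_zero 0) rfl

/-- Auxiliary: the algebra map `x ↦ (u x, D x; 0, v x)` that encodes a twisted derivation. -/
def sderHom (i : R →ₐ[k] A) (u v : Omega i →ₐ[k] B) (f₀ f₁ : A →ₗ[k] B)
    (h₀ : ∀ a b, f₀ (a * b) = f₀ a * v (incl i b) + u (incl i a) * f₀ b)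
    (h₁ : ∀ a b, f₁ (a * b) = f₁ a * v (incl i b) + u (dgen i a) * f₀ b
      + (f₀ a * v (dgen i b) + u (incl i a) * f₁ b))
    (hR : ∀ r, f₁ (i r) = 0) : Omega i →ₐ[k] Matrix (Fin 2) (Fin 2) B :=
  Omega.lift i
    (AlgHom.ofLinearMap (upper (u.toLinearMap ∘ₗ (incl i).toLinearMap) f₀
        (v.toLinearMap ∘ₗ (incl i).toLinearMap))
      (by
        have h : f₀ 1 = 0 := by simpa using h₀ 1 1
        rw [upper_apply, Matrix.one_fin_two, h]
        simp only [LinearMap.comp_apply, AlgHom.toLinearMap_apply, map_one])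
      (fun a b => by
        rw [upper_apply, upper_apply, upper_apply, upper_mul, h₀]
        simp only [LinearMap.comp_apply, AlgHom.toLinearMap_apply, map_mul]))
    (upper (u.toLinearMap ∘ₗ dgen i) f₁ (v.toLinearMap ∘ₗ dgen i))
    (fun a b => by
      simp only [AlgHom.ofLinearMap_apply, upper_apply, upper_mul, upper_add, h₁,
        LinearMap.comp_apply, AlgHom.toLinearMap_apply, dgen_mul, map_add, map_mul])
    (fun r => by
      simp only [upper_apply, hR, LinearMap.comp_apply, dgen_base, map_zero]
      exact mat_ext rfl rfl rfl rfl)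

/-- The unique linear map `D` on `Ω_R A` with `D (x y) = D x · v y + u x · D y`, `D a = f₀ a` and
`D (da) = f₁ a`. -/
def sder (i : R →ₐ[k] A) (u v : Omega i →ₐ[k] B) (f₀ f₁ : A →ₗ[k] B)
    (h₀ : ∀ a b, f₀ (a * b) = f₀ a * v (incl i b) + u (incl i a) * f₀ b)
    (h₁ : ∀ a b, f₁ (a * b) = f₁ a * v (incl i b) + u (dgen i a) * f₀ b
      + (f₀ a * v (dgen i b) + u (incl i a) * f₁ b))
    (hR : ∀ r, f₁ (i r) = 0) : Omega i →ₗ[k] B :=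
  (Matrix.entryLinearMap k B (0 : Fin 2) (1 : Fin 2)) ∘ₗ
    (sderHom i u v f₀ f₁ h₀ h₁ hR).toLinearMap

section sder
variable (i : R →ₐ[k] A) (u v : Omega i →ₐ[k] B) (f₀ f₁ : A →ₗ[k] B)
    (h₀ : ∀ a b, f₀ (a * b) = f₀ a * v (incl i b) + u (incl i a) * f₀ b)
    (h₁ : ∀ a b, f₁ (a * b) = f₁ a * v (incl i b) + u (dgen i a) * f₀ b
      + (f₀ a * v (dgen i b) + u (incl i a) * f₁ b))
    (hR : ∀ r, f₁ (i r) = 0)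

lemma sder_incl (a : A) : sder i u v f₀ f₁ h₀ h₁ hR (incl i a) = f₀ a := by
  simp [sder, sderHom, upper_apply]

lemma sder_dgen (a : A) : sder i u v f₀ f₁ h₀ h₁ hR (dgen i a) = f₁ a := by
  simp [sder, sderHom, upper_apply]

lemma sderHom_apply (x : Omega i) :
    sderHom i u v f₀ f₁ h₀ h₁ hR x = !![u x, sder i u v f₀ f₁ h₀ h₁ hR x; 0, v x] := by
  have key : sderHom i u v f₀ f₁ h₀ h₁ hR x 0 0 = u x ∧
      sderHom i u v f₀ f₁ h₀ h₁ hR x 1 0 = 0 ∧ sderHom i u v f₀ f₁ h₀ h₁ hR x 1 1 = v x := by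
    induction x using Omega.induction with
    | hs c => simp [Matrix.algebraMap_matrix_apply]
    | h0 a => simp [sderHom, upper_apply]
    | h1 a => simp [sderHom, upper_apply]
    | hadd x y hx hy => simp [hx, hy]
    | hmul x y hx hy => simp [Matrix.mul_apply, hx, hy]
  exact mat_ext key.1 rfl key.2.1 key.2.2

lemma sder_mul (x y : Omega i) : sder i u v f₀ f₁ h₀ h₁ hR (x * y) =
    sder i u v f₀ f₁ h₀ h₁ hR x * v y + u x * sder i u v f₀ f₁ h₀ h₁ hR y := by
  have h := congrFun (congrFun (map_mul (sderHom i u v f₀ f₁ h₀ h₁ hR) x y) 0) 1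
  rw [sderHom_apply, sderHom_apply, sderHom_apply] at h
  simpa [Matrix.mul_apply, add_comm] using h

end sder

/-- The parity automorphism of `Ω_R A`: it is `(-1)^n` in degree `n`. -/
def sgn (i : R →ₐ[k] A) : Omega i →ₐ[k] Omega i :=
  Omega.lift i (incl i) (-dgen i)
    (fun a b => by simp only [LinearMap.neg_apply, dgen_mul, neg_add, neg_mul, mul_neg])
    (fun r => by simp [dgen_base])

/-- The de Rham differential of `Ω_R A`: the superderivation with `a ↦ da` and `da ↦ 0`. -/
def dOmega (i : R →ₐ[k] A) : Omega i →ₗ[k] Omega i :=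
  sder i (sgn i) (AlgHom.id k _) (dgen i) 0
    (fun a b => by simp [sgn, dgen_mul])
    (fun a b => by simp [sgn])
    (fun r => rfl)

lemma dOmega_mul (i : R →ₐ[k] A) (x y : Omega i) :
    dOmega i (x * y) = dOmega i x * y + sgn i x * dOmega i y := sder_mul ..

@[simp] lemma dOmega_incl (i : R →ₐ[k] A) (a : A) : dOmega i (incl i a) = dgen i a :=
  sder_incl ..

@[simp] lemma dOmega_dgen (i : R →ₐ[k] A) (a : A) : dOmega i (dgen i a) = 0 :=
  sder_dgen ..

@[simp] lemma sgn_incl (i : R →ₐ[k] A) (a : A) : sgn i (incl i a) = incl i a := by simp [sgn]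

@[simp] lemma sgn_dgen (i : R →ₐ[k] A) (a : A) : sgn i (dgen i a) = -dgen i a := by simp [sgn]

lemma dgen_pow_deg (i : R →ₐ[k] A) (n : ℕ) {x : Omega i}
    (hx : x ∈ LinearMap.range (dgen i) ^ n) :
    sgn i x = (-1) ^ n * x ∧ dOmega i x = 0 := by
  induction n generalizing x with
  | zero =>
    rw [pow_zero, Submodule.mem_one] at hx
    obtain ⟨c, rfl⟩ := hx
    have h1 : dOmega i (algebraMap k _ c) = 0 := by
      have h : dgen i 1 = 0 := by simpa using dgen_base i 1
      rw [Algebra.algebraMap_eq_smul_one, map_smul, ← map_one (incl i), dOmega_incl, h, smul_zero]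
    exact ⟨by simp, h1⟩
  | succ n ih =>
    rw [pow_succ] at hx
    induction hx using Submodule.mul_induction_on' with
    | mem_mul_mem y hy z hz =>
      obtain ⟨a, rfl⟩ := hz
      obtain ⟨h1, h2⟩ := ih hy
      refine ⟨?_, ?_⟩
      · rw [map_mul, h1, sgn_dgen, pow_succ]; simp [mul_assoc]
      · rw [dOmega_mul, h2, dOmega_dgen]; simp
    | add x _ y _ hx hy =>
      exact ⟨by rw [map_add, hx.1, hy.1, mul_add], by rw [map_add, hx.2, hy.2, add_zero]⟩

lemma sgn_of_mem (i : R →ₐ[k] A) {n : ℕ} {x : Omega i} (hx : x ∈ Omega.deg i n) :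
    sgn i x = (-1) ^ n * x := by
  induction hx using Submodule.mul_induction_on' with
  | mem_mul_mem y hy z hz =>
    obtain ⟨a, rfl⟩ := hy
    rw [map_mul, (dgen_pow_deg i n hz).1, AlgHom.toLinearMap_apply, sgn_incl]
    rcases neg_one_pow_eq_or (Omega i) n with h | h <;> simp [h]
  | add x _ y _ hx hy => rw [map_add, hx, hy, mul_add]

lemma dOmega_mem (i : R →ₐ[k] A) {n : ℕ} {x : Omega i} (hx : x ∈ Omega.deg i n) :
    dOmega i x ∈ Omega.deg i (n + 1) := by
  induction hx using Submodule.mul_induction_on' with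
  | mem_mul_mem y hy z hz =>
    obtain ⟨a, rfl⟩ := hy
    rw [dOmega_mul, (dgen_pow_deg i n hz).2, AlgHom.toLinearMap_apply, dOmega_incl, mul_zero,
      add_zero, ← one_mul (dgen i a * z), Omega.deg, pow_succ']
    exact Submodule.mul_mem_mul ⟨1, map_one (incl i)⟩ (Submodule.mul_mem_mul ⟨a, rfl⟩ hz)
  | add x _ y _ hx hy => rw [map_add]; exact add_mem hx hy

/-! ### The Karoubi-de Rham complex -/

/-- The span of all supercommutators `αβ - (-1)^{kl} βα`, `α ∈ Ω^k`, `β ∈ Ω^l`. -/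
def superComm (i : R →ₐ[k] A) : Submodule k (Omega i) :=
  Submodule.span k {x | ∃ (m n : ℕ) (α β : Omega i), α ∈ Omega.deg i m ∧ β ∈ Omega.deg i n ∧
    x = α * β - (-1) ^ (m * n) * (β * α)}

/-- The Karoubi-de Rham complex `DR_R A = Ω_R A / [Ω_R A, Ω_R A]`, all degrees together. -/
abbrev DR (i : R →ₐ[k] A) : Type (max uk uA) := Omega i ⧸ superComm i

/-- `DR^n_R A`, the image of `Ω^n_R A` in `DR_R A`. -/
def DR.deg (i : R →ₐ[k] A) (n : ℕ) : Submodule k (DR i) :=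
  (Omega.deg i n).map (superComm i).mkQ

lemma dOmega_superComm (i : R →ₐ[k] A) :
    superComm i ≤ (superComm i).comap (dOmega i) := by
  refine Submodule.span_le.2 ?_
  rintro _ ⟨m, n, α, β, hα, hβ, rfl⟩
  have e1 : dOmega i α * β - (-1) ^ ((m + 1) * n) * (β * dOmega i α) ∈ superComm i :=
    Submodule.subset_span ⟨m + 1, n, _, _, dOmega_mem i hα, hβ, rfl⟩
  have e2 : α * dOmega i β - (-1) ^ (m * (n + 1)) * (dOmega i β * α) ∈ superComm i :=
    Submodule.subset_span ⟨m, n + 1, _, _, hα, dOmega_mem i hβ, rfl⟩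
  have hd : ∀ p : ℕ, ∀ x : Omega i, dOmega i ((-1) ^ p * x) = (-1) ^ p * dOmega i x := by
    intro p x
    rcases neg_one_pow_eq_or (Omega i) p with h | h <;> simp [h]
  have key : dOmega i (α * β - (-1) ^ (m * n) * (β * α)) =
      (dOmega i α * β - (-1) ^ ((m + 1) * n) * (β * dOmega i α)) +
      (-1 : k) ^ m • (α * dOmega i β - (-1) ^ (m * (n + 1)) * (dOmega i β * α)) := by
    rw [map_sub, hd, dOmega_mul, dOmega_mul, sgn_of_mem i hα, sgn_of_mem i hβ]
    rw [show (m + 1) * n = m * n + n by ring, show m * (n + 1) = m * n + m by ring]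
    rw [pow_add _ (m * n) n, pow_add _ (m * n) m]
    rcases neg_one_pow_eq_or (Omega i) (m * n) with h1 | h1 <;>
    rcases Nat.even_or_odd m with h2 | h2 <;>
    rcases Nat.even_or_odd n with h3 | h3 <;>
    simp only [h1, h2.neg_one_pow, h3.neg_one_pow, one_smul, neg_smul] <;> noncomm_ring
  rw [SetLike.mem_coe, Submodule.mem_comap, key]
  exact add_mem e1 (Submodule.smul_mem _ _ e2)

/-- The de Rham differential of `DR_R A`. -/
def dDR (i : R →ₐ[k] A) : DR i →ₗ[k] DR i :=
  (superComm i).mapQ (superComm i) (dOmega i) (dOmega_superComm i)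

/-! ### Derivations, double derivations, inner derivations -/

section lie

attribute [local instance] LieRing.ofAssociativeRing

/-- `Der_R(A)`: the Lie algebra of `k`-linear derivations `A → A` that vanish on `R`. -/
def Der (i : R →ₐ[k] A) : LieSubalgebra k (Module.End k A) where
  carrier := {D | (∀ a b, D (a * b) = D a * b + a * D b) ∧ ∀ r, D (i r) = 0}
  add_mem' := by
    rintro D E ⟨h1, h2⟩ ⟨h3, h4⟩
    refine ⟨fun a b => ?_, fun r => ?_⟩
    · simp only [LinearMap.add_apply, h1, h3]; noncomm_ring
    · simp [h2, h4]
  zero_mem' := ⟨fun a b => by simp, fun r => by simp⟩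
  smul_mem' := by
    rintro c D ⟨h1, h2⟩
    exact ⟨fun a b => by simp [h1], fun r => by simp [h2]⟩
  lie_mem' := by
    rintro D E ⟨h1, h2⟩ ⟨h3, h4⟩
    refine ⟨fun a b => ?_, fun r => ?_⟩
    · simp only [LieRing.of_associative_ring_bracket, LinearMap.sub_apply, Module.End.mul_apply,
        h1, h3, map_add]
      noncomm_ring
    · simp [LieRing.of_associative_ring_bracket, h2, h4]

/-- `Inn_R(A)`: the Lie ideal of the inner derivations `ad m : a ↦ a m - m a`, `m ∈ A^R`. -/
def Inn (i : R →ₐ[k] A) : LieIdeal k (Der i) where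
  carrier := {D | ∃ m : A, (∀ r, i r * m = m * i r) ∧ ∀ a, D.1 a = a * m - m * a}
  add_mem' := by
    rintro D E ⟨m, h1, h2⟩ ⟨n, h3, h4⟩
    refine ⟨m + n, fun r => by rw [mul_add, add_mul, h1, h3], fun a => ?_⟩
    change D.1 a + E.1 a = _
    rw [h2, h4]; noncomm_ring
  zero_mem' := ⟨0, by simp, fun a => by simp⟩
  smul_mem' := by
    rintro c D ⟨m, h1, h2⟩
    refine ⟨c • m, fun r => by simp [h1], fun a => ?_⟩
    change c • D.1 a = _
    rw [h2]; simp [smul_sub]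
  lie_mem := by
    rintro D E ⟨m, h1, h2⟩
    refine ⟨D.1 m, fun r => ?_, fun a => ?_⟩
    · have := congrArg D.1 (h1 r)
      simpa [D.2.1, D.2.2] using this
    · change D.1 (E.1 a) - E.1 (D.1 a) = _
      rw [h2, h2, map_sub, D.2.1, D.2.1]; noncomm_ring

end lie

/-- `DDer_R(A)`: the space of double derivations, i.e. of `k`-linear derivations `Θ : A → A ⊗ A`
vanishing on `R`, for the outer bimodule structure `b (x ⊗ y) c = b x ⊗ y c`. -/
def DDer (i : R →ₐ[k] A) : Submodule k (A →ₗ[k] A ⊗[k] A) where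
  carrier := {Θ | (∀ a b, Θ (a * b) = Θ a * (1 ⊗ₜ b) + (a ⊗ₜ 1) * Θ b) ∧ ∀ r, Θ (i r) = 0}
  add_mem' := by
    rintro D E ⟨h1, h2⟩ ⟨h3, h4⟩
    refine ⟨fun a b => ?_, fun r => ?_⟩
    · simp only [LinearMap.add_apply, h1, h3]; noncomm_ring
    · simp [h2, h4]
  zero_mem' := ⟨fun a b => by simp, fun r => by simp⟩
  smul_mem' := by
    rintro c D ⟨h1, h2⟩
    exact ⟨fun a b => by simp [h1], fun r => by simp [h2]⟩

/-- The inner bimodule structure `b (x ⊗ y) c = x c ⊗ b y` of `B ⊗ B`. -/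
def inner (b c : B) : B ⊗[k] B →ₗ[k] B ⊗[k] B :=
  TensorProduct.map (LinearMap.mulRight k c) (LinearMap.mulLeft k b)

@[simp] lemma inner_tmul (b c x y : B) :
    inner (k := k) b c (x ⊗ₜ[k] y) = (x * c) ⊗ₜ[k] (b * y) := by
  simp [inner]

lemma inner_outer (b c x y : B) (T : B ⊗[k] B) :
    inner b c ((x ⊗ₜ 1) * T * (1 ⊗ₜ y)) = (x ⊗ₜ 1) * inner b c T * (1 ⊗ₜ y) := by
  induction T using TensorProduct.induction_on with
  | zero => simp
  | tmul p q => simp [mul_assoc]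
  | add p q hp hq => simp only [mul_add, add_mul, map_add, hp, hq]

/-- The bimodule structure of `DDer_R(A)`: `(b Θ c)(q) = b · Θ(q) · c`, inner structure. -/
def DDer.act (i : R →ₐ[k] A) (b c : A) : DDer i →ₗ[k] DDer i where
  toFun Θ := ⟨inner b c ∘ₗ Θ.1, fun x y => by
      have h1 := inner_outer b c 1 y (Θ.1 x)
      have h2 := inner_outer b c x 1 (Θ.1 y)
      simp only [← Algebra.TensorProduct.one_def, one_mul, mul_one] at h1 h2
      simp [Θ.2.1, h1, h2], fun r => by simp [Θ.2.2]⟩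
  map_add' Θ Φ := Subtype.ext (by simp [LinearMap.comp_add])
  map_smul' c Θ := Subtype.ext (by simp [LinearMap.comp_smul])

/-- The map `m_* : DDer_R(A) → Der_R(A)` induced by the multiplication of `A`. -/
def mStar (i : R →ₐ[k] A) : DDer i →ₗ[k] Der i where
  toFun Θ := ⟨LinearMap.mul' k A ∘ₗ Θ.1, fun x y => by
      have h1 : ∀ T : A ⊗[k] A, LinearMap.mul' k A (T * (1 ⊗ₜ y)) = LinearMap.mul' k A T * y := by
        intro T
        induction T using TensorProduct.induction_on with
        | zero => simp
        | tmul p q => simp [mul_assoc]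
        | add p q hp hq => simp only [add_mul, map_add, hp, hq]
      have h2 : ∀ T : A ⊗[k] A, LinearMap.mul' k A ((x ⊗ₜ 1) * T) = x * LinearMap.mul' k A T := by
        intro T
        induction T using TensorProduct.induction_on with
        | zero => simp
        | tmul p q => simp [mul_assoc]
        | add p q hp hq => simp only [mul_add, map_add, hp, hq]
      simp [Θ.2.1, h1, h2], fun r => by simp [Θ.2.2]⟩
  map_add' Θ Φ := Subtype.ext (by simp [LinearMap.comp_add])
  map_smul' c Θ := Subtype.ext (by simp [LinearMap.comp_smul])

/-! ### Contractions -/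

/-- The contraction `i_Θ : Ω → Ω ⊗ Ω`: the superderivation (outer bimodule structure) with
`a ↦ 0` and `da ↦ Θ(a)`. -/
def contr (i : R →ₐ[k] A) (Θ : DDer i) : Omega i →ₗ[k] Omega i ⊗[k] Omega i :=
  sder i ((Algebra.TensorProduct.includeLeft : Omega i →ₐ[k] Omega i ⊗[k] Omega i).comp (sgn i))
    (Algebra.TensorProduct.includeRight : Omega i →ₐ[k] Omega i ⊗[k] Omega i) 0
    ((Algebra.TensorProduct.map (incl i) (incl i)).toLinearMap ∘ₗ Θ.1)
    (fun a b => by simp)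
    (fun a b => by
      change Algebra.TensorProduct.map (incl i) (incl i) (Θ.1 (a * b)) =
        Algebra.TensorProduct.map (incl i) (incl i) (Θ.1 a) * (1 ⊗ₜ incl i b)
          + _ * 0 + (0 * _ + (sgn i (incl i a) ⊗ₜ 1) *
            Algebra.TensorProduct.map (incl i) (incl i) (Θ.1 b))
      rw [Θ.2.1, map_add, map_mul, map_mul, Algebra.TensorProduct.map_tmul,
        Algebra.TensorProduct.map_tmul, map_one, sgn_incl, mul_zero, zero_mul, add_zero, zero_add])
    (fun r => by simp [Θ.2.2])

lemma contr_mul (i : R →ₐ[k] A) (Θ : DDer i) (x y : Omega i) :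
    contr i Θ (x * y) = contr i Θ x * (1 ⊗ₜ y) + (sgn i x ⊗ₜ 1) * contr i Θ y := sder_mul ..

@[simp] lemma contr_incl (i : R →ₐ[k] A) (Θ : DDer i) (a : A) : contr i Θ (incl i a) = 0 :=
  sder_incl ..

@[simp] lemma contr_dgen (i : R →ₐ[k] A) (Θ : DDer i) (a : A) :
    contr i Θ (dgen i a) = Algebra.TensorProduct.map (incl i) (incl i) (Θ.1 a) :=
  sder_dgen ..

/-- The map `(α ⊗ β) ↦ (α ⊗ β)^⋄`, equal to `(-1)^{mn} β α` for `α ∈ Ω^m`, `β ∈ Ω^n`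
(see `diamond_of_mem`).  With `s` the parity automorphism, it is
`α ⊗ β ↦ (β α + β s(α) + s(β) α - s(β) s(α)) / 2`. -/
def diamond (i : R →ₐ[k] A) : Omega i ⊗[k] Omega i →ₗ[k] Omega i :=
  TensorProduct.lift ((2⁻¹ : k) •
    ((LinearMap.mul k (Omega i)).flip
      + (LinearMap.mul k (Omega i)).flip.compl₁₂ (sgn i).toLinearMap LinearMap.id
      + (LinearMap.mul k (Omega i)).flip.compl₁₂ LinearMap.id (sgn i).toLinearMap
      - (LinearMap.mul k (Omega i)).flip.compl₁₂ (sgn i).toLinearMap (sgn i).toLinearMap))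

lemma diamond_tmul (i : R →ₐ[k] A) (α β : Omega i) : diamond i (α ⊗ₜ β) =
    (2⁻¹ : k) • (β * α + β * sgn i α + sgn i β * α - sgn i β * sgn i α) := by
  simp [diamond]

lemma half_add [CharZero k] {V : Type*} [AddCommGroup V] [Module k V] (x : V) :
    (2⁻¹ : k) • (x + x) = x := by
  rw [← two_smul k x, smul_smul, inv_mul_cancel₀ two_ne_zero, one_smul]

lemma diamond_of_mem [CharZero k] (i : R →ₐ[k] A) {m n : ℕ} {α β : Omega i}
    (hα : α ∈ Omega.deg i m) (hβ : β ∈ Omega.deg i n) :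
    diamond i (α ⊗ₜ β) = (-1) ^ (m * n) * (β * α) := by
  rw [diamond_tmul, sgn_of_mem i hα, sgn_of_mem i hβ, pow_mul]
  refine Eq.trans ?_ (half_add (k := k) _)
  congr 1
  rcases Nat.even_or_odd m with h2 | h2 <;>
  rcases Nat.even_or_odd n with h3 | h3 <;>
  simp only [h2.neg_one_pow, h3.neg_one_pow, one_pow, one_mul, neg_mul, mul_neg] <;> abel

lemma contr_add (i : R →ₐ[k] A) (Θ Φ : DDer i) (x : Omega i) :
    contr i (Θ + Φ) x = contr i Θ x + contr i Φ x := by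
  induction x using Omega.induction with
  | hs c => rw [← (incl i).commutes c]; simp only [contr_incl, add_zero]
  | h0 a => simp only [contr_incl, add_zero]
  | h1 a => simp only [contr_dgen, Submodule.coe_add, LinearMap.add_apply, map_add]
  | hadd x y hx hy => rw [map_add, map_add, map_add, hx, hy]; abel
  | hmul x y hx hy => rw [contr_mul, contr_mul, contr_mul, hx, hy, add_mul, mul_add]; abel

lemma contr_smul (i : R →ₐ[k] A) (c : k) (Θ : DDer i) (x : Omega i) :
    contr i (c • Θ) x = c • contr i Θ x := by
  induction x using Omega.induction with
  | hs c => rw [← (incl i).commutes c]; simp only [contr_incl, smul_zero]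
  | h0 a => simp only [contr_incl, smul_zero]
  | h1 a => simp only [contr_dgen, Submodule.coe_smul, LinearMap.smul_apply, map_smul]
  | hadd x y hx hy => rw [map_add, map_add, hx, hy, smul_add]
  | hmul x y hx hy =>
    rw [contr_mul, contr_mul, hx, hy, smul_add, smul_mul_assoc, mul_smul_comm]

lemma contr_act (i : R →ₐ[k] A) (b c : A) (Θ : DDer i) (x : Omega i) :
    contr i (DDer.act i b c Θ) x = inner (incl i b) (incl i c) (contr i Θ x) := by
  induction x using Omega.induction with
  | hs c => rw [← (incl i).commutes c]; simp only [contr_incl, map_zero]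
  | h0 a => simp only [contr_incl, map_zero]
  | h1 a =>
    rw [contr_dgen, contr_dgen]
    change Algebra.TensorProduct.map (incl i) (incl i) (inner b c (Θ.1 a)) = _
    induction Θ.1 a using TensorProduct.induction_on with
    | zero => simp only [map_zero]
    | tmul p q => rw [inner_tmul, Algebra.TensorProduct.map_tmul, Algebra.TensorProduct.map_tmul,
        inner_tmul, map_mul, map_mul]
    | add p q hp hq => simp only [map_add, hp, hq]
  | hadd x y hx hy => rw [map_add, map_add, map_add, hx, hy]
  | hmul x y hx hy =>
    have h1 := inner_outer (k := k) (incl i b) (incl i c) 1 y (contr i Θ x)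
    have h2 := inner_outer (k := k) (incl i b) (incl i c) (sgn i x) 1 (contr i Θ y)
    simp only [← Algebra.TensorProduct.one_def, one_mul, mul_one] at h1 h2
    rw [contr_mul, contr_mul, hx, hy, map_add, h1, h2]

lemma diamond_inner (i : R →ₐ[k] A) (b c : A) (T : Omega i ⊗[k] Omega i) :
    diamond i (inner (incl i b) (incl i c) T) = incl i b * diamond i T * incl i c := by
  induction T using TensorProduct.induction_on with
  | zero => simp only [map_zero, mul_zero, zero_mul]
  | tmul p q =>
    rw [inner_tmul, diamond_tmul, diamond_tmul, mul_smul_comm, smul_mul_assoc, map_mul, map_mul,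
      sgn_incl, sgn_incl]
    simp only [mul_add, add_mul, mul_sub, sub_mul, mul_assoc]
  | add p q hp hq => simp only [map_add, hp, hq, mul_add, add_mul]

/-- The reduced contraction `Ω_R A → Ω_R A`, `α ↦ (i_Θ α)^⋄`, as a linear function of `Θ`. -/
def redContr (i : R →ₐ[k] A) : DDer i →ₗ[k] Omega i →ₗ[k] Omega i where
  toFun Θ := diamond i ∘ₗ contr i Θ
  map_add' Θ Φ := by
    ext x
    simp only [LinearMap.comp_apply, LinearMap.add_apply, contr_add, map_add]
  map_smul' c Θ := by
    ext x
    simp only [LinearMap.comp_apply, LinearMap.smul_apply, contr_smul, map_smul, RingHom.id_apply]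

lemma redContr_apply (i : R →ₐ[k] A) (Θ : DDer i) (x : Omega i) :
    redContr i Θ x = diamond i (contr i Θ x) := rfl

lemma redContr_act (i : R →ₐ[k] A) (b c : A) (Θ : DDer i) (x : Omega i) :
    redContr i (DDer.act i b c Θ) x = incl i b * redContr i Θ x * incl i c := by
  rw [redContr_apply, redContr_apply, contr_act, diamond_inner]

lemma sgn_sgn (i : R →ₐ[k] A) (x : Omega i) : sgn i (sgn i x) = x := by
  induction x using Omega.induction with
  | hs c => simp only [AlgHom.commutes]
  | h0 a => simp only [sgn_incl]
  | h1 a => simp only [sgn_dgen, map_neg, neg_neg]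
  | hadd x y hx hy => rw [map_add, map_add, hx, hy]
  | hmul x y hx hy => rw [map_mul, map_mul, hx, hy]

lemma contr_sgn (i : R →ₐ[k] A) (Θ : DDer i) (x : Omega i) :
    contr i Θ (sgn i x) = -Algebra.TensorProduct.map (sgn i) (sgn i) (contr i Θ x) := by
  induction x using Omega.induction with
  | hs c => rw [← (incl i).commutes c]; simp only [sgn_incl, contr_incl, map_zero, neg_zero]
  | h0 a => simp only [sgn_incl, contr_incl, map_zero, neg_zero]
  | h1 a =>
    rw [sgn_dgen, map_neg, contr_dgen]
    congr 1
    induction Θ.1 a using TensorProduct.induction_on with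
    | zero => simp only [map_zero]
    | tmul p q => simp only [Algebra.TensorProduct.map_tmul, sgn_incl]
    | add p q hp hq => rw [map_add, map_add, ← hp, ← hq]
  | hadd x y hx hy => rw [map_add, map_add, map_add, map_add, hx, hy, neg_add]
  | hmul x y hx hy =>
    rw [map_mul, contr_mul, contr_mul, hx, hy, map_add, map_mul, map_mul,
      Algebra.TensorProduct.map_tmul, Algebra.TensorProduct.map_tmul, map_one, neg_add, neg_mul,
      mul_neg]

/-- Cyclicity of `⋄`: moving a factor `β` of degree parity `n` from the right to the left of a
tensor of parity `τ`. -/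
lemma diamond_cyclic (i : R →ₐ[k] A) {τ : k} (n : ℕ) (hτ : τ = 1 ∨ τ = -1)
    {β : Omega i} (hβ : sgn i β = (-1 : k) ^ n • β) {T : Omega i ⊗[k] Omega i}
    (hT : Algebra.TensorProduct.map (sgn i) (sgn i) T = τ • T) :
    diamond i (T * (1 ⊗ₜ β)) = τ ^ n • diamond i ((β ⊗ₜ 1) * T) := by
  generalize hε : (-1 : k) ^ n = ε at hβ
  let F : Omega i ⊗[k] Omega i →ₗ[k] Omega i :=
    TensorProduct.lift ((LinearMap.mul k (Omega i)).flip.compl₁₂ LinearMap.id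
      (LinearMap.mulRight k β))
  have hF : ∀ x y, F (x ⊗ₜ y) = y * β * x := fun x y => by simp [F]
  let S1 : Omega i ⊗[k] Omega i →ₐ[k] Omega i ⊗[k] Omega i :=
    Algebra.TensorProduct.map (sgn i) (AlgHom.id k _)
  let SS : Omega i ⊗[k] Omega i →ₐ[k] Omega i ⊗[k] Omega i :=
    Algebra.TensorProduct.map (sgn i) (sgn i)
  have e1 : ∀ U, diamond i (U * (1 ⊗ₜ β)) =
      (2⁻¹ : k) • (F U + F (S1 U) + ε • F (S1 (SS U)) - ε • F (SS U)) := by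
    intro U
    induction U using TensorProduct.induction_on with
    | zero => simp only [map_zero, zero_mul, smul_zero, add_zero, sub_zero]
    | tmul x y =>
      simp only [S1, SS, Algebra.TensorProduct.tmul_mul_tmul, Algebra.TensorProduct.map_tmul,
        AlgHom.id_apply, hF, diamond_tmul, sgn_sgn, map_mul, hβ, mul_one, smul_mul_assoc,
        mul_smul_comm]
    | add p q hp hq =>
      simp only [add_mul, map_add, hp, hq, ← smul_add]
      congr 1
      simp only [smul_add]
      abel
  have e2 : ∀ U, diamond i ((β ⊗ₜ 1) * U) =
      (2⁻¹ : k) • (F U + ε • F (S1 U) + F (S1 (SS U)) - ε • F (SS U)) := by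
    intro U
    induction U using TensorProduct.induction_on with
    | zero => simp only [map_zero, mul_zero, smul_zero, add_zero, sub_zero]
    | tmul x y =>
      simp only [S1, SS, Algebra.TensorProduct.tmul_mul_tmul, Algebra.TensorProduct.map_tmul,
        AlgHom.id_apply, hF, diamond_tmul, sgn_sgn, map_mul, hβ, one_mul, smul_mul_assoc,
        mul_smul_comm, mul_assoc]
    | add p q hp hq =>
      simp only [mul_add, map_add, hp, hq, ← smul_add]
      congr 1
      simp only [smul_add]
      abel
  have hSS : SS T = τ • T := hT
  rw [e1, e2, hSS]
  simp only [map_smul]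
  subst hε
  rcases Nat.even_or_odd n with h | h
  · have h1 : τ ^ n = 1 := by
      rcases hτ with rfl | rfl
      · exact one_pow n
      · exact h.neg_one_pow
    simp only [h.neg_one_pow, h1, one_smul]
  · have h1 : τ ^ n = τ := by
      rcases hτ with rfl | rfl
      · exact one_pow n
      · exact h.neg_one_pow
    rw [h1, h.neg_one_pow, smul_comm τ (2⁻¹ : k)]
    congr 1
    rcases hτ with rfl | rfl <;> simp only [one_smul, neg_smul] <;> abel

lemma neg_one_pow_mul (i : R →ₐ[k] A) (n : ℕ) (x : Omega i) :
    (-1) ^ n * x = (-1 : k) ^ n • x := by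
  rcases Nat.even_or_odd n with h | h <;> simp [h.neg_one_pow]

lemma redContr_superComm (i : R →ₐ[k] A) (Θ : DDer i) :
    superComm i ≤ LinearMap.ker (redContr i Θ) := by
  refine Submodule.span_le.2 ?_
  rintro _ ⟨m, n, α, β, hα, hβ, rfl⟩
  have par : ∀ {n : ℕ} {x : Omega i}, x ∈ Omega.deg i n →
      Algebra.TensorProduct.map (sgn i) (sgn i) (contr i Θ x) =
        (-(-1 : k) ^ n) • contr i Θ x := by
    intro n x hx
    have h := contr_sgn i Θ x
    rw [sgn_of_mem i hx, neg_one_pow_mul, map_smul] at h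
    rw [neg_smul, h, neg_neg]
  have sq : ∀ n : ℕ, ((-1 : k) ^ n = 1 ∨ (-1 : k) ^ n = -1) := fun n => neg_one_pow_eq_or k n
  have nsq : ∀ n : ℕ, (-(-1 : k) ^ n = 1 ∨ -(-1 : k) ^ n = -1) := fun n => by
    rcases sq n with h | h <;> simp [h]
  have sα := sgn_of_mem i hα
  have sβ := sgn_of_mem i hβ
  rw [neg_one_pow_mul] at sα sβ
  have c1 := diamond_cyclic i n (nsq m) sβ (par hα)
  have c2 := diamond_cyclic i m (nsq n) sα (par hβ)
  rw [SetLike.mem_coe, LinearMap.mem_ker, map_sub, neg_one_pow_mul, map_smul, redContr_apply,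
    redContr_apply, contr_mul, contr_mul, map_add, map_add, c1, c2, sα, sβ, pow_mul]
  have t : ∀ (c : k) (x : Omega i), (c • x) ⊗ₜ[k] (1 : Omega i) = c • (x ⊗ₜ[k] (1 : Omega i)) :=
    fun c x => (TensorProduct.smul_tmul' c x 1)
  simp only [t, smul_mul_assoc, map_smul]
  rcases Nat.even_or_odd m with h2 | h2 <;>
  rcases Nat.even_or_odd n with h3 | h3 <;>
  simp only [h2.neg_one_pow, h3.neg_one_pow, one_pow, one_smul, neg_smul, neg_neg] <;> abel

/-- The reduced contraction on the Karoubi-de Rham complex. -/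
def redContrDR (i : R →ₐ[k] A) (Θ : DDer i) : DR i →ₗ[k] Omega i :=
  (superComm i).liftQ (redContr i Θ) (redContr_superComm i Θ)

lemma dgen_mem (i : R →ₐ[k] A) (a : A) : dgen i a ∈ Omega.deg i 1 := by
  rw [Omega.deg, pow_one, ← one_mul (dgen i a)]
  exact Submodule.mul_mem_mul ⟨1, map_one (incl i)⟩ ⟨a, rfl⟩

lemma incl_mul_mem (i : R →ₐ[k] A) (a : A) {n : ℕ} {x : Omega i} (hx : x ∈ Omega.deg i n) :
    incl i a * x ∈ Omega.deg i n := by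
  induction hx using Submodule.mul_induction_on' with
  | mem_mul_mem y hy z hz =>
    obtain ⟨b, rfl⟩ := hy
    rw [← mul_assoc, AlgHom.toLinearMap_apply, ← map_mul]
    exact Submodule.mul_mem_mul ⟨a * b, rfl⟩ hz
  | add x _ y _ hx hy => rw [mul_add]; exact add_mem hx hy

lemma mul_incl_mem (i : R →ₐ[k] A) (a : A) {x : Omega i} (hx : x ∈ Omega.deg i 1) :
    x * incl i a ∈ Omega.deg i 1 := by
  rw [Omega.deg, pow_one] at hx
  induction hx using Submodule.mul_induction_on' with
  | mem_mul_mem y hy z hz =>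
    obtain ⟨b, rfl⟩ := hy
    obtain ⟨c, rfl⟩ := hz
    have : (incl i).toLinearMap b * dgen i c * incl i a =
        incl i b * dgen i (c * a) - incl i (b * c) * dgen i a := by
      rw [dgen_mul, map_mul, AlgHom.toLinearMap_apply]; noncomm_ring
    rw [this]
    exact sub_mem (incl_mul_mem i _ (dgen_mem i _)) (incl_mul_mem i _ (dgen_mem i _))
  | add x _ y _ hx hy => rw [add_mul]; exact add_mem hx hy

lemma redContr_mem (i : R →ₐ[k] A) (Θ : DDer i) {x : Omega i} (hx : x ∈ Omega.deg i 2) :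
    redContr i Θ x ∈ Omega.deg i 1 := by
  have tm : ∀ (a b : A) (x : Omega i), x ∈ Omega.deg i 1 →
      incl i a * x * incl i b ∈ Omega.deg i 1 := fun a b x hx =>
    mul_incl_mem i b (incl_mul_mem i a hx)
  have e1 : ∀ (a c : A) (T : A ⊗[k] A), diamond i ((incl i a ⊗ₜ 1) *
      (Algebra.TensorProduct.map (incl i) (incl i) T * (1 ⊗ₜ dgen i c))) ∈ Omega.deg i 1 := by
    intro a c T
    induction T using TensorProduct.induction_on with
    | zero => simp only [map_zero, zero_mul, mul_zero, zero_mem]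
    | tmul p q =>
      have h : incl i q * dgen i c * (incl i a * incl i p) ∈ Omega.deg i 1 := by
        rw [← map_mul]; exact tm _ _ _ (dgen_mem i c)
      simp only [Algebra.TensorProduct.map_tmul, Algebra.TensorProduct.tmul_mul_tmul, one_mul,
        mul_one, diamond_tmul, map_mul, sgn_incl, sgn_dgen, mul_neg, neg_mul]
      exact Submodule.smul_mem _ _ (sub_mem (add_mem (add_mem h h) (neg_mem h)) (neg_mem h))
    | add p q hp hq => simp only [map_add, add_mul, mul_add]; exact add_mem hp hq
  have e2 : ∀ (a b : A) (T : A ⊗[k] A), diamond i ((incl i a ⊗ₜ 1) *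
      ((dgen i b ⊗ₜ 1) * Algebra.TensorProduct.map (incl i) (incl i) T)) ∈ Omega.deg i 1 := by
    intro a b T
    induction T using TensorProduct.induction_on with
    | zero => simp only [map_zero, mul_zero, zero_mem]
    | tmul p q =>
      have h : incl i q * (incl i a * (dgen i b * incl i p)) ∈ Omega.deg i 1 := by
        rw [← mul_assoc, ← mul_assoc, ← map_mul]; exact tm _ _ _ (dgen_mem i b)
      simp only [Algebra.TensorProduct.map_tmul, Algebra.TensorProduct.tmul_mul_tmul, one_mul,
        diamond_tmul, map_mul, sgn_incl, sgn_dgen, mul_neg, neg_mul]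
      exact Submodule.smul_mem _ _ (sub_mem (add_mem (add_mem h (neg_mem h)) h) (neg_mem h))
    | add p q hp hq => simp only [map_add, mul_add]; exact add_mem hp hq
  rw [Omega.deg, pow_two] at hx
  induction hx using Submodule.mul_induction_on' with
  | mem_mul_mem y hy z hz =>
    obtain ⟨a, rfl⟩ := hy
    induction hz using Submodule.mul_induction_on' with
    | mem_mul_mem y hy z hz =>
      obtain ⟨b, rfl⟩ := hy
      obtain ⟨c, rfl⟩ := hz
      rw [redContr_apply, AlgHom.toLinearMap_apply, contr_mul, contr_mul, contr_incl, zero_mul,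
        zero_add, sgn_incl, sgn_dgen, contr_dgen, contr_dgen, TensorProduct.neg_tmul, neg_mul,
        mul_add, mul_neg, map_add, map_neg]
      exact add_mem (e1 a c _) (neg_mem (e2 a b _))
    | add x _ y _ hx hy => rw [mul_add, map_add]; exact add_mem hx hy
  | add x _ y _ hx hy => rw [map_add]; exact add_mem hx hy

/-- The map `DDer_R(A) → Ω¹_R A`, `Θ ↦ ı_Θ ω`, given by a class `ω ∈ DR²_R A`. -/
def iota (i : R →ₐ[k] A) (ω : DR.deg i 2) : DDer i →ₗ[k] Omega.deg i 1 where
  toFun Θ := ⟨redContrDR i Θ ω.1, by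
    obtain ⟨x, hx, h⟩ := ω.2
    rw [← h]
    exact redContr_mem i Θ hx⟩
  map_add' Θ Φ := by
    refine Subtype.ext ?_
    obtain ⟨x, hx, h⟩ := ω.2
    change redContrDR i (Θ + Φ) ω.1 = redContrDR i Θ ω.1 + redContrDR i Φ ω.1
    rw [← h]
    change redContr i (Θ + Φ) x = redContr i Θ x + redContr i Φ x
    rw [map_add, LinearMap.add_apply]
  map_smul' c Θ := by
    refine Subtype.ext ?_
    obtain ⟨x, hx, h⟩ := ω.2
    change redContrDR i (c • Θ) ω.1 = c • redContrDR i Θ ω.1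
    rw [← h]
    change redContr i (c • Θ) x = c • redContr i Θ x
    rw [map_smul, LinearMap.smul_apply]

lemma iota_act (i : R →ₐ[k] A) (ω : DR.deg i 2) (b c : A) (Θ : DDer i) :
    (iota i ω (DDer.act i b c Θ) : Omega i) = incl i b * iota i ω Θ * incl i c := by
  obtain ⟨x, hx, h⟩ := ω.2
  change redContrDR i (DDer.act i b c Θ) ω.1 = incl i b * redContrDR i Θ ω.1 * incl i c
  rw [← h]
  exact redContr_act i b c Θ x

/-! ### Commutator quotients -/

/-- `[A, A]`. -/
def comm (k : Type uk) [Field k] (A : Type uA) [Ring A] [Algebra k A] : Submodule k A :=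
  Submodule.span k {x | ∃ a b : A, x = a * b - b * a}

/-- `A_♮ = A / [A, A]`. -/
abbrev CommQuot (k : Type uk) [Field k] (A : Type uA) [Ring A] [Algebra k A] : Type uA :=
  A ⧸ comm k A

/-- `[A, Ω¹_R A]`. -/
def commForms (i : R →ₐ[k] A) : Submodule k (Omega.deg i 1) :=
  Submodule.span k {x | ∃ (a : A) (α : Omega.deg i 1),
    (x : Omega i) = incl i a * α - α * incl i a}

/-- `DR¹_R A = (Ω¹_R A)_♮ = Ω¹_R A / [A, Ω¹_R A]`. -/
abbrev DROne (i : R →ₐ[k] A) : Type (max uk uA) := Omega.deg i 1 ⧸ commForms i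

instance (i : R →ₐ[k] A) : AddCommGroup (DDer i) :=
  @Submodule.addCommGroup k (A →ₗ[k] A ⊗[k] A) _
    (@LinearMap.addCommGroup k k A (A ⊗[k] A) _ _ _ TensorProduct.addCommGroup _ _ _) _ (DDer i)

/-- `[A, DDer_R(A)]`. -/
def commDDer (i : R →ₐ[k] A) : Submodule k (DDer i) :=
  Submodule.span k {x | ∃ (a : A) (Θ : DDer i), x = DDer.act i a 1 Θ - DDer.act i 1 a Θ}

/-- `DDer_R(A)_♮`. -/
abbrev DDerNat (i : R →ₐ[k] A) : Type uA := DDer i ⧸ commDDer i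

/-- The map `d : A_♮ → DR¹_R A`. -/
def dNat (i : R →ₐ[k] A) : CommQuot k A →ₗ[k] DROne i :=
  (comm k A).mapQ (commForms i)
    ((dgen i).codRestrict (Omega.deg i 1) (dgen_mem i))
    (by
      refine Submodule.span_le.2 ?_
      rintro _ ⟨a, b, rfl⟩
      have e : ((dgen i).codRestrict (Omega.deg i 1) (dgen_mem i)) (a * b - b * a) =
          (⟨incl i a * dgen i b - dgen i b * incl i a, sub_mem
            (incl_mul_mem i a (dgen_mem i b)) (mul_incl_mem i a (dgen_mem i b))⟩ : Omega.deg i 1)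
          - ⟨incl i b * dgen i a - dgen i a * incl i b, sub_mem
            (incl_mul_mem i b (dgen_mem i a)) (mul_incl_mem i b (dgen_mem i a))⟩ := by
        refine Subtype.ext ?_
        change dgen i (a * b - b * a) = (incl i a * dgen i b - dgen i b * incl i a) -
          (incl i b * dgen i a - dgen i a * incl i b)
        rw [map_sub, dgen_mul, dgen_mul]
        abel
      rw [SetLike.mem_coe, Submodule.mem_comap, e]
      exact sub_mem (Submodule.subset_span ⟨a, ⟨_, dgen_mem i b⟩, rfl⟩)
        (Submodule.subset_span ⟨b, ⟨_, dgen_mem i a⟩, rfl⟩))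

/-- The map `m_♮ : DDer_R(A)_♮ → Der_R(A)`. -/
def mNat (i : R →ₐ[k] A) : DDerNat i →ₗ[k] Der i :=
  (commDDer i).liftQ (mStar i) (by
    refine Submodule.span_le.2 ?_
    rintro _ ⟨a, Θ, rfl⟩
    rw [SetLike.mem_coe, LinearMap.mem_ker, map_sub, sub_eq_zero]
    refine Subtype.ext (LinearMap.ext fun q => ?_)
    change LinearMap.mul' k A (inner a 1 (Θ.1 q)) = LinearMap.mul' k A (inner 1 a (Θ.1 q))
    induction Θ.1 q using TensorProduct.induction_on with
    | zero => simp only [map_zero]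
    | tmul x y => simp [mul_assoc]
    | add x y hx hy => simp only [map_add, hx, hy])

lemma iota_commDDer (i : R →ₐ[k] A) (ω : DR.deg i 2) :
    commDDer i ≤ (commForms i).comap (iota i ω) := by
  refine Submodule.span_le.2 ?_
  rintro _ ⟨a, Θ, rfl⟩
  refine Submodule.subset_span ⟨a, iota i ω Θ, ?_⟩
  rw [map_sub (iota i ω), Submodule.coe_sub, iota_act, iota_act, map_one, one_mul, mul_one]

/-- The map `ı(ω)_♮ : DDer_R(A)_♮ → DR¹_R A` induced by `Θ ↦ ı_Θ ω`. -/
def iotaNat (i : R →ₐ[k] A) (ω : DR.deg i 2) : DDerNat i →ₗ[k] DROne i :=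
  (commDDer i).mapQ (commForms i) (iota i ω) (iota_commDDer i ω)

/-! ### Bi-symplectic forms and Hamiltonian derivations -/

/-- A class `ω ∈ DR²_R A` is bi-symplectic if it is closed and bi-nondegenerate. -/
structure IsBiSymplectic (i : R →ₐ[k] A) (ω : DR.deg i 2) : Prop where
  closed : dDR i ω = 0
  binondegenerate : Function.Bijective (iota i ω)

lemma iotaNat_bijective {i : R →ₐ[k] A} {ω : DR.deg i 2} (h : IsBiSymplectic i ω) :
    Function.Bijective (iotaNat i ω) := by
  let E := LinearEquiv.ofBijective (iota i ω) h.binondegenerate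
  have hE : ∀ x, E x = iota i ω x := fun x => rfl
  constructor
  · rw [← LinearMap.ker_eq_bot, LinearMap.ker_eq_bot']
    intro x hx
    obtain ⟨Θ, rfl⟩ := (commDDer i).mkQ_surjective x
    have h1 : iota i ω Θ ∈ commForms i := (Submodule.Quotient.mk_eq_zero _).1 hx
    have h2 : commForms i ≤ (commDDer i).comap E.symm.toLinearMap := by
      refine Submodule.span_le.2 ?_
      rintro y ⟨a, α, hy⟩
      refine Submodule.subset_span ⟨a, E.symm α, ?_⟩
      refine E.injective (Subtype.ext ?_)
      rw [map_sub]
      change (E (E.symm y) : Omega i) = E _ - E _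
      rw [hE (DDer.act i a 1 _), hE (DDer.act i 1 a _), iota_act, iota_act, ← hE,
        E.apply_symm_apply, E.apply_symm_apply, map_one, one_mul, mul_one, hy]
    have h3 : E.symm (iota i ω Θ) ∈ commDDer i := h2 h1
    rw [← hE, E.symm_apply_apply] at h3
    exact (Submodule.Quotient.mk_eq_zero _).2 h3
  · intro y
    obtain ⟨α, rfl⟩ := (commForms i).mkQ_surjective y
    obtain ⟨Θ, rfl⟩ := h.binondegenerate.2 α
    exact ⟨(commDDer i).mkQ Θ, rfl⟩

/-- The Hamilton operator `H_ω = m_♮ ∘ ı(ω)_♮⁻¹ : DR¹_R A → Der_R(A)`. -/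
def hamOp {i : R →ₐ[k] A} {ω : DR.deg i 2} (h : IsBiSymplectic i ω) : DROne i →ₗ[k] Der i :=
  mNat i ∘ₗ (LinearEquiv.ofBijective (iotaNat i ω) (iotaNat_bijective h)).symm.toLinearMap

/-- The Hamiltonian derivation `θ_p = H_ω(dp)`, `p ∈ A_♮`. -/
def theta {i : R →ₐ[k] A} {ω : DR.deg i 2} (h : IsBiSymplectic i ω) : CommQuot k A →ₗ[k] Der i :=
  hamOp h ∘ₗ dNat i

/-- The action of `Der_R(A)` on `A_♮`. -/
def derAct (i : R →ₐ[k] A) : Der i →ₗ[k] CommQuot k A →ₗ[k] CommQuot k A where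
  toFun D := (comm k A).mapQ (comm k A) D.1 (by
    refine Submodule.span_le.2 ?_
    rintro _ ⟨a, b, rfl⟩
    have e : D.1 (a * b - b * a) = (D.1 a * b - b * D.1 a) + (a * D.1 b - D.1 b * a) := by
      rw [map_sub, D.2.1, D.2.1]; abel
    rw [SetLike.mem_coe, Submodule.mem_comap, e]
    exact add_mem (Submodule.subset_span ⟨_, _, rfl⟩) (Submodule.subset_span ⟨_, _, rfl⟩))
  map_add' D E := by
    refine LinearMap.ext fun x => ?_
    obtain ⟨a, rfl⟩ := (comm k A).mkQ_surjective x
    rfl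
  map_smul' c D := by
    refine LinearMap.ext fun x => ?_
    obtain ⟨a, rfl⟩ := (comm k A).mkQ_surjective x
    rfl

/-- The pairing `{p, q} = θ_p(q) mod [A, A]` on `A_♮`. -/
def poisson {i : R →ₐ[k] A} {ω : DR.deg i 2} (h : IsBiSymplectic i ω) :
    CommQuot k A →ₗ[k] CommQuot k A →ₗ[k] CommQuot k A :=
  derAct i ∘ₗ theta h

/-- A bilinear pairing is a Lie bracket if it is alternating and satisfies the Jacobi identity. -/
structure IsLieBracket {V : Type*} [AddCommGroup V] [Module k V] (b : V →ₗ[k] V →ₗ[k] V) :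
    Prop where
  alt : ∀ x, b x x = 0
  jacobi : ∀ x y z, b x (b y z) + b y (b z x) + b z (b x y) = 0

/-! ### The distinguished double derivation and the moment element -/

/-- A symmetric separability element `e ∈ R ⊗ R`: `r e = e r` (outer structure), `e' e'' = 1` and
`e` is invariant under the flip. -/
structure IsSymmSep (e : R ⊗[k] R) : Prop where
  central : ∀ r : R, (r ⊗ₜ[k] (1 : R)) * e = e * ((1 : R) ⊗ₜ[k] r)
  mul_eq_one : LinearMap.mul' k R e = 1
  symm : TensorProduct.comm k R R e = e

/-- The double derivation `Δ(a) = a e' ⊗ e'' - e' ⊗ e'' a`. -/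
def Delta (i : R →ₐ[k] A) {e : R ⊗[k] R} (he : IsSymmSep e) : DDer i :=
  ⟨{ toFun := fun a => (a ⊗ₜ[k] (1 : A)) * Algebra.TensorProduct.map i i e
        - Algebra.TensorProduct.map i i e * ((1 : A) ⊗ₜ[k] a)
     map_add' := fun a b => by
        simp only [TensorProduct.add_tmul, TensorProduct.tmul_add, add_mul, mul_add]; abel
     map_smul' := fun c a => by
        simp only [← TensorProduct.smul_tmul', TensorProduct.tmul_smul, smul_mul_assoc,
          mul_smul_comm, smul_sub, RingHom.id_apply] },
   fun a b => by
      change ((a * b) ⊗ₜ[k] (1 : A)) * Algebra.TensorProduct.map i i e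
          - Algebra.TensorProduct.map i i e * ((1 : A) ⊗ₜ[k] (a * b)) =
        ((a ⊗ₜ[k] (1 : A)) * Algebra.TensorProduct.map i i e
          - Algebra.TensorProduct.map i i e * ((1 : A) ⊗ₜ[k] a)) * (1 ⊗ₜ b) +
        (a ⊗ₜ 1) * ((b ⊗ₜ[k] (1 : A)) * Algebra.TensorProduct.map i i e
          - Algebra.TensorProduct.map i i e * ((1 : A) ⊗ₜ[k] b))
      have e1 : (a * b) ⊗ₜ[k] (1 : A) = (a ⊗ₜ 1) * (b ⊗ₜ 1) := by simp
      have e2 : (1 : A) ⊗ₜ[k] (a * b) = (1 ⊗ₜ a) * (1 ⊗ₜ b) := by simp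
      rw [e1, e2]
      noncomm_ring,
   fun r => by
      change ((i r) ⊗ₜ[k] (1 : A)) * Algebra.TensorProduct.map i i e
          - Algebra.TensorProduct.map i i e * ((1 : A) ⊗ₜ[k] (i r)) = 0
      have h := congrArg (Algebra.TensorProduct.map i i) (he.central r)
      simp only [map_mul, Algebra.TensorProduct.map_tmul, map_one] at h
      rw [h, sub_self]⟩

/-- `w ∈ A` represents the class `μ_nc(ω) = d⁻¹(ı_Δ ω) ∈ A / R`, where `d : A / R → Ω¹_R A` is
the injective map induced by the universal derivation: this says `dw = ı_Δ ω` in `Ω¹_R A`. -/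
def IsMomentElement (i : R →ₐ[k] A) {e : R ⊗[k] R} (he : IsSymmSep e) (ω : DR.deg i 2) (w : A) :
    Prop :=
  dgen i w = iota i ω (Delta i he)

/-! ### Hamiltonian reduction -/

/-- The two-sided ideal `A w A`. -/
def idealOf (w : A) : Ideal A := (TwoSidedIdeal.span {w}).asIdeal

instance (w : A) : (idealOf w).IsTwoSided := by unfold idealOf; infer_instance

/-- The algebra `A_w = A / A w A`. -/
abbrev Red (w : A) : Type uA := A ⧸ idealOf w

/-- The projection `A → A_w`. -/
abbrev redMk (k : Type uk) [Field k] {A : Type uA} [Ring A] [Algebra k A] (w : A) :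
    A →ₐ[k] Red w := Ideal.Quotient.mkₐ k (idealOf w)

/-- The structure map `R → A_w`. -/
def redBase (i : R →ₐ[k] A) (w : A) : R →ₐ[k] Red w := (redMk k w).comp i

/-- The map `A_♮ → B_♮` induced by an algebra map `A → B`. -/
def natMap (f : A →ₐ[k] B) : CommQuot k A →ₗ[k] CommQuot k B :=
  (comm k A).mapQ (comm k B) f.toLinearMap (by
    refine Submodule.span_le.2 ?_
    rintro _ ⟨a, b, rfl⟩
    exact Submodule.subset_span ⟨f a, f b, by simp⟩)

end NCSymp

end

noncomputable section

namespace NCSymp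

universe uk uR uA uB

variable {k : Type uk} {R : Type uR} {A : Type uA} {B : Type uB}
variable [Field k] [Ring R] [Algebra k R] [Ring A] [Algebra k A] [Ring B] [Algebra k B]

/-! ### Homogeneous components and supercommutators -/

/-! The argument is the classical one of symplectic geometry, carried out modulo supercommutators.
Each `p` is represented by some `a`, and bi-nondegeneracy gives a double derivation `Θ` with `ı_Θ ω
= da`; then `θ_p = m ∘ Θ`. Two facts link double derivations to ordinary ones. First, multiplying
out `i_Θ` gives the contraction with `m ∘ Θ`, and multiplication differs from `⋄` by
supercommutators (`superComm_eq_range`), so `i_{θ_p} ω = dp` in `DR` (`contrDR_theta`). Second,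
`i_D` anticommutes with `ı_Θ` (`contrDer_redContr`), so `D(a)`, which is `i_D (ı_Θ ω)` when `ı_Θ ω =
da`, depends only on `i_D ω`; hence `D` is determined by `i_D ω` (`contrDR_injective`).

Cartan's formulas now give `i_{[θ_p, θ_q]} ω = d(θ_p(q))`, so `θ` intertwines the brackets
(`theta_poisson`). The identity `i_D i_D = 0`, read in degree zero, makes the bracket alternating
(`poisson_self`), and Jacobi follows.

For the reduction, `θ_p(w) = i_{θ_p} ı_Δ ω = -ı_Δ(dp) = 0`, because `⋄` sends both terms of `Δ(a)`
to `e'' a e'` (`theta_moment`). So `θ_p` preserves `AwA`, and by skew-symmetry the bracket descends.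
For the map to outer derivations, a class coming from `AwA` must act by inner derivations. Such a
class is represented by some `cw`, and `d(cw) = dc · w + c · dw` corresponds to the double
derivation `Ψ w + c Δ`, where `ı_Ψ ω = dc`. The first summand gives `Ψ'(a) w Ψ''(a)`, which lies in
`AwA`; the second gives `a m - m a` with `m = e' c e''`, which commutes with `R`
(`theta_mul_moment`). -/

lemma dgen_mul_mem (i : R →ₐ[k] A) (a : A) {n : ℕ} {x : Omega i} (hx : x ∈ Omega.deg i n) :
    dgen i a * x ∈ Omega.deg i (n + 1) := by
  induction hx using Submodule.mul_induction_on' with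
  | mem_mul_mem y hy z hz =>
    obtain ⟨b, rfl⟩ := hy
    have key : ∀ a b : A, incl i a * (dgen i b * z) ∈ Omega.deg i (n + 1) := fun a b => by
      rw [Omega.deg, pow_succ']
      exact Submodule.mul_mem_mul ⟨a, rfl⟩ (Submodule.mul_mem_mul ⟨b, rfl⟩ hz)
    -- The Leibniz rule moves the coefficient to the left of the differential; the factor `incl i 1`
    -- gives both terms the shape handled by `key`.
    have e : dgen i a * ((incl i).toLinearMap b * z) =
        incl i 1 * (dgen i (a * b) * z) - incl i a * (dgen i b * z) := by
      rw [dgen_mul, map_one, AlgHom.toLinearMap_apply]; noncomm_ring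
    rw [e]
    exact sub_mem (key _ _) (key _ _)
  | add x _ y _ hx hy => rw [mul_add]; exact add_mem hx hy

lemma deg_mul_mem (i : R →ₐ[k] A) {m n : ℕ} {x y : Omega i} (hx : x ∈ Omega.deg i m)
    (hy : y ∈ Omega.deg i n) : x * y ∈ Omega.deg i (m + n) := by
  -- The induction peels differentials off the right end of `z` into `y`, so `n` and `y` have to
  -- stay general.
  have key : ∀ (m : ℕ) {z : Omega i}, z ∈ LinearMap.range (dgen i) ^ m →
      ∀ {n : ℕ} {y : Omega i}, y ∈ Omega.deg i n → z * y ∈ Omega.deg i (m + n) := by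
    intro m
    induction m with
    | zero =>
      intro z hz n y hy
      rw [pow_zero, Submodule.mem_one] at hz
      obtain ⟨c, rfl⟩ := hz
      rw [zero_add, ← Algebra.smul_def]
      exact Submodule.smul_mem _ c hy
    | succ m ih =>
      intro z hz n y hy
      rw [pow_succ] at hz
      induction hz using Submodule.mul_induction_on' with
      | mem_mul_mem u hu v hv =>
        obtain ⟨a, rfl⟩ := hv
        rw [mul_assoc, show m + 1 + n = m + (n + 1) by ring]
        exact ih hu (dgen_mul_mem i a hy)
      | add u _ v _ hu hv => rw [add_mul]; exact add_mem hu hv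
  induction hx using Submodule.mul_induction_on' with
  | mem_mul_mem u hu v hv =>
    obtain ⟨a, rfl⟩ := hu
    rw [mul_assoc]
    exact incl_mul_mem i a (key m hv hy)
  | add u _ v _ hu hv => rw [add_mul]; exact add_mem hu hv

lemma incl_mem (i : R →ₐ[k] A) (a : A) : incl i a ∈ Omega.deg i 0 := by
  rw [Omega.deg, pow_zero, mul_one]
  exact ⟨a, rfl⟩

/-- Homogeneous forms span `Ω_R A`. -/
lemma iSup_deg (i : R →ₐ[k] A) : ⨆ n, Omega.deg i n = ⊤ := by
  refine eq_top_iff.2 fun x _ => ?_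
  have single : ∀ n, Omega.deg i n ≤ ⨆ n, Omega.deg i n := le_iSup _
  induction x using Omega.induction with
  | hs c => rw [← (incl i).commutes c]; exact single 0 (incl_mem i _)
  | h0 a => exact single 0 (incl_mem i a)
  | h1 a => exact single 1 (dgen_mem i a)
  | hadd x y hx hy => exact add_mem (hx trivial) (hy trivial)
  | hmul x y hx hy =>
    refine (Submodule.iSup_mul _ _).trans_le ?_ (Submodule.mul_mem_mul (hx trivial) (hy trivial))
    refine iSup_le fun m => (Submodule.mul_iSup _ _).trans_le (iSup_le fun n => ?_)
    exact (Submodule.mul_le.2 fun u hu v hv => deg_mul_mem i hu hv).trans (single (m + n))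

/-- The super commutator space is the range of `α ⊗ β ↦ α β - (α ⊗ β)^⋄`. -/
lemma superComm_eq_range [CharZero k] (i : R →ₐ[k] A) :
    superComm i = LinearMap.range (LinearMap.mul' k (Omega i) - diamond i) := by
  apply le_antisymm
  · refine Submodule.span_le.2 ?_
    rintro _ ⟨m, n, α, β, hα, hβ, rfl⟩
    exact ⟨α ⊗ₜ β, by rw [LinearMap.sub_apply, LinearMap.mul'_apply, diamond_of_mem i hα hβ]⟩
  · rintro _ ⟨T, rfl⟩
    induction T using TensorProduct.induction_on with
    | zero => rw [map_zero]; exact zero_mem _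
    | add S T hS hT => rw [map_add]; exact add_mem hS hT
    | tmul α β =>
      -- The sign formula for `⋄` holds only for homogeneous factors, so both factors are decomposed
      -- into homogeneous summands.
      have hα : α ∈ ⨆ n, Omega.deg i n := by rw [iSup_deg]; trivial
      have hβ : β ∈ ⨆ n, Omega.deg i n := by rw [iSup_deg]; trivial
      induction hα using Submodule.iSup_induction' with
      | zero => rw [TensorProduct.zero_tmul, map_zero]; exact zero_mem _
      | add x y _ _ hx hy => rw [TensorProduct.add_tmul, map_add]; exact add_mem hx hy
      | mem m α hα =>
        induction hβ using Submodule.iSup_induction' with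
        | zero => rw [TensorProduct.tmul_zero, map_zero]; exact zero_mem _
        | add x y _ _ hx hy => rw [TensorProduct.tmul_add, map_add]; exact add_mem hx hy
        | mem n β hβ =>
          refine Submodule.subset_span ⟨m, n, α, β, hα, hβ, ?_⟩
          rw [LinearMap.sub_apply, LinearMap.mul'_apply, diamond_of_mem i hα hβ]

lemma mul'_sub_diamond_mem [CharZero k] (i : R →ₐ[k] A) (T : Omega i ⊗[k] Omega i) :
    LinearMap.mul' k (Omega i) T - diamond i T ∈ superComm i := by
  rw [superComm_eq_range]
  exact ⟨T, rfl⟩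

/-! ### The degree zero part. -/

/-- The projection of `Ω_R A` to its degree zero part. -/
def projZero (i : R →ₐ[k] A) : Omega i →ₐ[k] A :=
  Omega.lift i (AlgHom.id k A) 0 (fun a b => by simp) (fun r => rfl)

@[simp] lemma projZero_incl (i : R →ₐ[k] A) (a : A) : projZero i (incl i a) = a := by
  simp [projZero]

@[simp] lemma projZero_dgen (i : R →ₐ[k] A) (a : A) : projZero i (dgen i a) = 0 := by
  simp [projZero]

lemma incl_injective (i : R →ₐ[k] A) : Function.Injective (incl i) :=
  Function.LeftInverse.injective (projZero_incl i)

lemma projZero_sgn (i : R →ₐ[k] A) (x : Omega i) : projZero i (sgn i x) = projZero i x := by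
  induction x using Omega.induction with
  | hs c => simp only [AlgHom.commutes]
  | h0 a => simp only [sgn_incl]
  | h1 a => simp only [sgn_dgen, map_neg, projZero_dgen, neg_zero]
  | hadd x y hx hy => simp only [map_add, hx, hy]
  | hmul x y hx hy => simp only [map_mul, hx, hy]

/-- Parity is invisible in degree zero, so `⋄` becomes the plain flip: its four terms average to
`(ba + ba + ba - ba) / 2 = ba`. This is how an identity in `DR` is turned into one in `A_♮`. -/
lemma projZero_superComm [CharZero k] (i : R →ₐ[k] A) :
    superComm i ≤ (comm k A).comap (projZero i).toLinearMap := by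
  rw [superComm_eq_range]
  rintro _ ⟨T, rfl⟩
  induction T using TensorProduct.induction_on with
  | zero => rw [map_zero]; exact zero_mem _
  | add S T hS hT => rw [map_add]; exact add_mem hS hT
  | tmul α β =>
    refine Submodule.subset_span ⟨projZero i α, projZero i β, ?_⟩
    rw [LinearMap.sub_apply, LinearMap.mul'_apply, diamond_tmul, AlgHom.toLinearMap_apply,
      map_sub, map_mul, map_smul, map_sub, map_add, map_add]
    simp only [map_mul, projZero_sgn, add_sub_cancel_right, half_add]

/-! ### Cartan calculus of derivations -/

/-- The contraction `i_D` of forms with a derivation `D`. -/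
def contrDer (i : R →ₐ[k] A) (D : Der i) : Omega i →ₗ[k] Omega i :=
  sder i (sgn i) (AlgHom.id k _) 0 ((incl i).toLinearMap ∘ₗ D.1)
    (fun a b => by simp)
    (fun a b => by simp [D.2.1])
    (fun r => by simp [D.2.2])

section contrDer

variable (i : R →ₐ[k] A) (D E : Der i)

lemma contrDer_mul (x y : Omega i) :
    contrDer i D (x * y) = contrDer i D x * y + sgn i x * contrDer i D y := sder_mul ..

@[simp] lemma contrDer_incl (a : A) : contrDer i D (incl i a) = 0 := sder_incl ..

@[simp] lemma contrDer_dgen (a : A) : contrDer i D (dgen i a) = incl i (D.1 a) := sder_dgen ..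

@[simp] lemma contrDer_algebraMap (c : k) : contrDer i D (algebraMap k _ c) = 0 := by
  rw [← (incl i).commutes c, contrDer_incl]

lemma sgn_contrDer (x : Omega i) : sgn i (contrDer i D x) = -contrDer i D (sgn i x) := by
  induction x using Omega.induction with
  | hs c => simp only [AlgHom.commutes, contrDer_algebraMap, map_zero, neg_zero]
  | h0 a => simp only [sgn_incl, contrDer_incl, map_zero, neg_zero]
  | h1 a => simp only [sgn_dgen, contrDer_dgen, sgn_incl, map_neg, neg_neg]
  | hadd x y hx hy => simp only [map_add, hx, hy, neg_add]
  | hmul x y hx hy => simp only [map_mul, contrDer_mul, map_add, hx, hy]; noncomm_ring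

/-- On a product the two cross terms cancel because `i_D` is odd; on generators `i_D` lands in
degree zero after one step. -/
lemma contrDer_contrDer_self (x : Omega i) : contrDer i D (contrDer i D x) = 0 := by
  induction x using Omega.induction with
  | hs c => simp only [contrDer_algebraMap, map_zero]
  | h0 a => simp only [contrDer_incl, map_zero]
  | h1 a => simp only [contrDer_dgen, contrDer_incl]
  | hadd x y hx hy => simp only [map_add, hx, hy, add_zero]
  | hmul x y hx hy =>
    simp only [contrDer_mul, map_add, hx, hy, sgn_contrDer]; noncomm_ring

lemma dOmega_algebraMap (c : k) : dOmega i (algebraMap k _ c) = 0 := by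
  rw [← (incl i).commutes c, dOmega_incl, ← i.commutes c, dgen_base]

lemma sgn_dOmega (x : Omega i) : sgn i (dOmega i x) = -dOmega i (sgn i x) := by
  induction x using Omega.induction with
  | hs c => simp only [AlgHom.commutes, dOmega_algebraMap, map_zero, neg_zero]
  | h0 a => simp only [sgn_incl, dOmega_incl, sgn_dgen]
  | h1 a => simp only [sgn_dgen, dOmega_dgen, map_zero, map_neg, neg_zero]
  | hadd x y hx hy => simp only [map_add, hx, hy, neg_add]
  | hmul x y hx hy => simp only [map_mul, dOmega_mul, map_add, hx, hy]; noncomm_ring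

/-- The Lie derivative, defined by Cartan's formula. -/
def lieDer : Omega i →ₗ[k] Omega i := dOmega i ∘ₗ contrDer i D + contrDer i D ∘ₗ dOmega i

lemma lieDer_apply (x : Omega i) :
    lieDer i D x = dOmega i (contrDer i D x) + contrDer i D (dOmega i x) := rfl

/-- A supercommutator of two odd superderivations is an even derivation: the sign-twisted cross
terms cancel in pairs. -/
lemma lieDer_mul (x y : Omega i) : lieDer i D (x * y) = lieDer i D x * y + x * lieDer i D y := by
  simp only [lieDer_apply, contrDer_mul, dOmega_mul, map_add, sgn_contrDer, sgn_dOmega, sgn_sgn]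
  noncomm_ring

@[simp] lemma lieDer_incl (a : A) : lieDer i D (incl i a) = incl i (D.1 a) := by
  simp [lieDer_apply]

@[simp] lemma lieDer_dgen (a : A) : lieDer i D (dgen i a) = dgen i (D.1 a) := by
  simp [lieDer_apply]

lemma sgn_lieDer (x : Omega i) : sgn i (lieDer i D x) = lieDer i D (sgn i x) := by
  simp only [lieDer_apply, map_add, sgn_contrDer, sgn_dOmega, map_neg, neg_neg]

/-- Both sides are superderivations of the same parity, so agreement on the generators `a` and `da`
suffices. -/
lemma lieDer_contrDer (x : Omega i) :
    lieDer i D (contrDer i E x) - contrDer i E (lieDer i D x) = contrDer i ⁅D, E⁆ x := by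
  induction x using Omega.induction with
  | hs c => simp [lieDer_apply, dOmega_algebraMap]
  | h0 a => simp
  | h1 a =>
    simp only [contrDer_dgen, lieDer_incl, lieDer_dgen, ← map_sub]
    rfl
  | hadd x y hx hy => rw [map_add (contrDer i ⁅D, E⁆), ← hx, ← hy]; simp only [map_add]; abel
  | hmul x y hx hy =>
    rw [contrDer_mul i ⁅D, E⁆, ← hx, ← hy]
    simp only [contrDer_mul, lieDer_mul, map_add, sgn_lieDer]
    noncomm_ring

/-! ### Contractions on `Ω ⊗ Ω` and their comparison with double derivations. -/

/-- The superderivation `i_D ⊗ 1 + 1 ⊗ i_D` of `Ω ⊗ Ω`, with the Koszul sign. -/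
def contrDerTensor : Omega i ⊗[k] Omega i →ₗ[k] Omega i ⊗[k] Omega i :=
  TensorProduct.map (contrDer i D) LinearMap.id +
    TensorProduct.map (sgn i).toLinearMap (contrDer i D)

lemma contrDerTensor_tmul (x y : Omega i) :
    contrDerTensor i D (x ⊗ₜ y) = contrDer i D x ⊗ₜ y + sgn i x ⊗ₜ contrDer i D y := rfl

lemma contrDer_mul' (T : Omega i ⊗[k] Omega i) :
    contrDer i D (LinearMap.mul' k _ T) = LinearMap.mul' k _ (contrDerTensor i D T) := by
  induction T using TensorProduct.induction_on with
  | zero => simp only [map_zero]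
  | add S T hS hT => simp only [map_add, hS, hT]
  | tmul x y => simp only [contrDerTensor_tmul, map_add, LinearMap.mul'_apply, contrDer_mul]

/-- The map `⋄` is multiplication after the signed flip, and the Koszul sign in `contrDerTensor`
makes it compatible with that flip. -/
lemma contrDer_diamond (T : Omega i ⊗[k] Omega i) :
    contrDer i D (diamond i T) = diamond i (contrDerTensor i D T) := by
  induction T using TensorProduct.induction_on with
  | zero => simp only [map_zero]
  | add S T hS hT => simp only [map_add, hS, hT]
  | tmul x y =>
    rw [contrDerTensor_tmul, map_add, diamond_tmul, diamond_tmul, diamond_tmul, map_smul,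
      ← smul_add]
    congr 1
    simp only [map_add, map_sub, contrDer_mul, sgn_contrDer, sgn_sgn]
    noncomm_ring

/-- Supercommutators are the values of multiplication minus `⋄`, and `i_D` passes through both maps
to the same tensor; no case analysis on degrees is needed. -/
lemma contrDer_superComm [CharZero k] : superComm i ≤ (superComm i).comap (contrDer i D) := by
  intro x hx
  rw [superComm_eq_range] at hx
  obtain ⟨T, rfl⟩ := hx
  rw [Submodule.mem_comap, LinearMap.sub_apply, map_sub, contrDer_mul', contrDer_diamond]
  exact mul'_sub_diamond_mem i _

lemma contrDerTensor_mul_right (T : Omega i ⊗[k] Omega i) (y : Omega i) :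
    contrDerTensor i D (T * (1 ⊗ₜ y)) = contrDerTensor i D T * (1 ⊗ₜ y) +
      Algebra.TensorProduct.map (sgn i) (sgn i) T * (1 ⊗ₜ contrDer i D y) := by
  induction T using TensorProduct.induction_on with
  | zero => simp only [zero_mul, map_zero, add_zero]
  | add S T hS hT => simp only [add_mul, map_add, hS, hT]; abel
  | tmul p q =>
    simp only [Algebra.TensorProduct.tmul_mul_tmul, contrDerTensor_tmul, mul_one, add_mul,
      Algebra.TensorProduct.map_tmul, contrDer_mul, TensorProduct.tmul_add, add_assoc]

lemma contrDerTensor_mul_left (x : Omega i) (T : Omega i ⊗[k] Omega i) :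
    contrDerTensor i D ((x ⊗ₜ 1) * T) =
      (contrDer i D x ⊗ₜ 1) * T + (sgn i x ⊗ₜ 1) * contrDerTensor i D T := by
  induction T using TensorProduct.induction_on with
  | zero => simp only [mul_zero, map_zero, add_zero]
  | add S T hS hT => simp only [mul_add, map_add, hS, hT]; abel
  | tmul p q =>
    simp only [Algebra.TensorProduct.tmul_mul_tmul, contrDerTensor_tmul, one_mul, mul_add,
      map_mul, contrDer_mul, TensorProduct.add_tmul, add_assoc]

/-- Two odd superderivations that each send `da` into degree zero, where the other one vanishes; the
parity signs cancel the cross terms on products. -/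
lemma contr_contrDer (Θ : DDer i) (x : Omega i) :
    contr i Θ (contrDer i D x) = -contrDerTensor i D (contr i Θ x) := by
  induction x using Omega.induction with
  | hs c =>
    rw [contrDer_algebraMap, ← (incl i).commutes c, contr_incl]; simp only [map_zero, neg_zero]
  | h0 a => simp only [contrDer_incl, contr_incl, map_zero, neg_zero]
  | h1 a =>
    rw [contrDer_dgen, contr_incl, contr_dgen]
    induction Θ.1 a using TensorProduct.induction_on with
    | zero => simp only [map_zero, neg_zero]
    | add S T hS hT => rw [map_add, map_add, neg_add, ← hS, ← hT, add_zero]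
    | tmul p q => simp [contrDerTensor_tmul]
  | hadd x y hx hy => simp only [map_add, hx, hy, neg_add]
  | hmul x y hx hy =>
    simp only [contrDer_mul, map_add, contr_mul, contr_sgn, hx, hy, contrDerTensor_mul_right,
      contrDerTensor_mul_left, sgn_contrDer, TensorProduct.neg_tmul]
    noncomm_ring

/-- Contractions with derivations and with double derivations anticommute. -/
lemma contrDer_redContr (Θ : DDer i) (x : Omega i) :
    contrDer i D (redContr i Θ x) = -redContr i Θ (contrDer i D x) := by
  rw [redContr_apply, redContr_apply, contr_contrDer, contrDer_diamond, map_neg, neg_neg]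

/-- Multiplication is a bimodule map for the outer structure, so it turns `i_Θ` into a
superderivation of `Ω`, which is fixed by its values on `a` and `da`. -/
lemma mul'_contr (Θ : DDer i) (x : Omega i) :
    LinearMap.mul' k _ (contr i Θ x) = contrDer i (mStar i Θ) x := by
  have hr : ∀ (T : Omega i ⊗[k] Omega i) (y : Omega i),
      LinearMap.mul' k _ (T * (1 ⊗ₜ y)) = LinearMap.mul' k _ T * y := by
    intro T y
    induction T using TensorProduct.induction_on with
    | zero => simp
    | tmul p q => simp [mul_assoc]
    | add p q hp hq => simp only [add_mul, map_add, hp, hq]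
  have hl : ∀ (x : Omega i) (T : Omega i ⊗[k] Omega i),
      LinearMap.mul' k _ ((x ⊗ₜ 1) * T) = x * LinearMap.mul' k _ T := by
    intro x T
    induction T using TensorProduct.induction_on with
    | zero => simp
    | tmul p q => simp [mul_assoc]
    | add p q hp hq => simp only [mul_add, map_add, hp, hq]
  induction x using Omega.induction with
  | hs c => rw [contrDer_algebraMap, ← (incl i).commutes c, contr_incl, map_zero]
  | h0 a => simp only [contr_incl, contrDer_incl, map_zero]
  | h1 a =>
    rw [contr_dgen, contrDer_dgen]
    change _ = incl i (LinearMap.mul' k A (Θ.1 a))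
    induction Θ.1 a using TensorProduct.induction_on with
    | zero => simp only [map_zero]
    | tmul p q => simp
    | add p q hp hq => simp only [map_add, hp, hq]
  | hadd x y hx hy => simp only [map_add, hx, hy]
  | hmul x y hx hy => simp only [contr_mul, contrDer_mul, map_add, hr, hl, hx, hy]

lemma contrDer_mStar_sub_redContr_mem [CharZero k] (Θ : DDer i) (x : Omega i) :
    contrDer i (mStar i Θ) x - redContr i Θ x ∈ superComm i := by
  rw [← mul'_contr, redContr_apply]
  exact mul'_sub_diamond_mem i _

end contrDer

/-- The contraction with a derivation on the Karoubi-de Rham complex. -/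
def contrDR [CharZero k] (i : R →ₐ[k] A) (D : Der i) : DR i →ₗ[k] DR i :=
  (superComm i).mapQ (superComm i) (contrDer i D) (contrDer_superComm i D)

/-! ### Hamiltonian derivations -/

section hamiltonian

variable {i : R →ₐ[k] A} {ω : DR.deg i 2}

lemma contrDR_mStar [CharZero k] (Θ : DDer i) :
    contrDR i (mStar i Θ) ω = (superComm i).mkQ (iota i ω Θ : Omega i) := by
  obtain ⟨x, hx, h⟩ := ω.2
  change contrDR i (mStar i Θ) ω.1 = (superComm i).mkQ (redContrDR i Θ ω.1)
  rw [← h]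
  exact (Submodule.Quotient.eq _).2 (contrDer_mStar_sub_redContr_mem i Θ x)

/-- When `ı_Θ ω` is exact, say `da`, the left side is `D(a)`. Both the non-degeneracy for
derivations and the vanishing on the moment element are read off from this. -/
lemma contrDer_iota [CharZero k] (D : Der i) (Θ : DDer i) :
    contrDer i D (iota i ω Θ : Omega i) = -redContrDR i Θ (contrDR i D ω) := by
  obtain ⟨x, hx, h⟩ := ω.2
  change contrDer i D (redContrDR i Θ ω.1) = -redContrDR i Θ (contrDR i D ω.1)
  rw [← h]
  exact contrDer_redContr i D Θ x

/-- Non-degeneracy on the level of derivations. -/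
lemma contrDR_injective [CharZero k] (h : IsBiSymplectic i ω) {D E : Der i}
    (hDE : contrDR i D ω = contrDR i E ω) : D = E := by
  refine Subtype.ext (LinearMap.ext fun a => incl_injective i ?_)
  -- Writing `da = ı_Θ ω` expresses `D(a) = i_D(da)` through `i_D ω` alone.
  obtain ⟨Θ, hΘ⟩ := h.binondegenerate.2 ⟨dgen i a, dgen_mem i a⟩
  have hD := contrDer_iota (ω := ω) D Θ
  have hE := contrDer_iota (ω := ω) E Θ
  rw [hΘ] at hD hE
  rw [← contrDer_dgen, ← contrDer_dgen, hD, hE, hDE]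

/-- Replaces the inverse on commutator quotients by a genuine solution `Θ` in `Ω¹`; computations
with `θ` start from such a `Θ`. -/
lemma theta_mk_eq_mStar (h : IsBiSymplectic i ω) {a : A} {Θ : DDer i}
    (hΘ : (iota i ω Θ : Omega i) = dgen i a) : theta h ((comm k A).mkQ a) = mStar i Θ := by
  change mNat i ((LinearEquiv.ofBijective (iotaNat i ω) (iotaNat_bijective h)).symm
    (dNat i ((comm k A).mkQ a))) = mNat i ((commDDer i).mkQ Θ)
  congr 1
  rw [LinearEquiv.symm_apply_eq]
  refine congrArg (commForms i).mkQ (?_ : _ = iota i ω Θ)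
  exact Subtype.ext hΘ.symm

lemma exists_iota_eq_dgen (h : IsBiSymplectic i ω) (a : A) :
    ∃ Θ : DDer i, (iota i ω Θ : Omega i) = dgen i a := by
  obtain ⟨Θ, hΘ⟩ := h.binondegenerate.2 ⟨dgen i a, dgen_mem i a⟩
  exact ⟨Θ, congrArg Subtype.val hΘ⟩

/-- `i_{θ_p} ω = dp` in `DR_R A`. -/
lemma contrDR_theta [CharZero k] (h : IsBiSymplectic i ω) (a : A) :
    contrDR i (theta h ((comm k A).mkQ a)) ω = (superComm i).mkQ (dgen i a) := by
  obtain ⟨Θ, hΘ⟩ := exists_iota_eq_dgen h a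
  rw [theta_mk_eq_mStar h hΘ, contrDR_mStar, hΘ]

lemma poisson_mk (h : IsBiSymplectic i ω) (p : CommQuot k A) (a : A) :
    poisson h p ((comm k A).mkQ a) = (comm k A).mkQ ((theta h p).1 a) := rfl

lemma contrDR_mkQ [CharZero k] (D : Der i) (x : Omega i) :
    contrDR i D ((superComm i).mkQ x) = (superComm i).mkQ (contrDer i D x) := rfl

lemma dDR_mkQ (x : Omega i) : dDR i ((superComm i).mkQ x) = (superComm i).mkQ (dOmega i x) := rfl

lemma mkQ_eq_mkQ_iff {V : Type*} [AddCommGroup V] [Module k V] (S : Submodule k V) {x y : V} :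
    S.mkQ x = S.mkQ y ↔ x - y ∈ S := Submodule.Quotient.eq S

lemma mkQ_eq_zero_iff {V : Type*} [AddCommGroup V] [Module k V] (S : Submodule k V) {x : V} :
    S.mkQ x = 0 ↔ x ∈ S := Submodule.Quotient.mk_eq_zero S

lemma dOmega_mem_superComm {x : Omega i} (hx : x ∈ superComm i) : dOmega i x ∈ superComm i :=
  Submodule.mem_comap.1 (dOmega_superComm i hx)

lemma contrDer_mem_superComm [CharZero k] (D : Der i) {x : Omega i} (hx : x ∈ superComm i) :
    contrDer i D x ∈ superComm i :=
  Submodule.mem_comap.1 (contrDer_superComm i D hx)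

lemma lieDer_superComm [CharZero k] (D : Der i) {x : Omega i} (hx : x ∈ superComm i) :
    lieDer i D x ∈ superComm i := by
  rw [lieDer_apply]
  exact add_mem (dOmega_mem_superComm (contrDer_mem_superComm D hx))
    (contrDer_mem_superComm D (dOmega_mem_superComm hx))

/-- Hamiltonian derivations preserve the closed form. -/
lemma lieDer_mem_of_contrDR [CharZero k] {D : Der i} {a : A} {x : Omega i}
    (hx : dDR i ((superComm i).mkQ x) = 0)
    (hD : contrDR i D ((superComm i).mkQ x) = (superComm i).mkQ (dgen i a)) :
    lieDer i D x ∈ superComm i := by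
  rw [dDR_mkQ, mkQ_eq_zero_iff] at hx
  rw [contrDR_mkQ, mkQ_eq_mkQ_iff] at hD
  have e3 : dOmega i (contrDer i D x - dgen i a) ∈ superComm i := dOmega_mem_superComm hD
  rw [map_sub, dOmega_dgen, sub_zero] at e3
  rw [lieDer_apply]
  exact add_mem e3 (contrDer_mem_superComm D hx)

/-- Apply `L_D i_E - i_E L_D = i_{[D, E]}`: `L_D` sends `db` to `d(D b)`, and the term `i_E L_D x`
is a supercommutator since `D` preserves the form. -/
lemma contrDR_lie [CharZero k] {D E : Der i} {a b : A} {x : Omega i}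
    (hx : dDR i ((superComm i).mkQ x) = 0)
    (hD : contrDR i D ((superComm i).mkQ x) = (superComm i).mkQ (dgen i a))
    (hE : contrDR i E ((superComm i).mkQ x) = (superComm i).mkQ (dgen i b)) :
    contrDR i ⁅D, E⁆ ((superComm i).mkQ x) = (superComm i).mkQ (dgen i (D.1 b)) := by
  have e1 := lieDer_mem_of_contrDR hx hD
  rw [contrDR_mkQ, mkQ_eq_mkQ_iff] at hE ⊢
  have e2 := lieDer_superComm D hE
  have e3 : contrDer i E (lieDer i D x) ∈ superComm i := contrDer_mem_superComm E e1
  rw [map_sub, lieDer_dgen] at e2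
  rw [← lieDer_contrDer]
  have e4 := sub_mem e2 e3
  rwa [sub_right_comm] at e4

/-- `p ↦ θ_p` intertwines the brackets. -/
lemma theta_poisson [CharZero k] (h : IsBiSymplectic i ω) (p q : CommQuot k A) :
    theta h (poisson h p q) = ⁅theta h p, theta h q⁆ := by
  obtain ⟨a, rfl⟩ := (comm k A).mkQ_surjective p
  obtain ⟨b, rfl⟩ := (comm k A).mkQ_surjective q
  refine contrDR_injective h ?_
  rw [poisson_mk, contrDR_theta]
  have hc := h.closed
  have ha := contrDR_theta h a
  have hb := contrDR_theta h b
  obtain ⟨x, hx⟩ := (superComm i).mkQ_surjective ω.1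
  rw [← hx] at ha hb hc ⊢
  exact (contrDR_lie hc ha hb).symm

lemma mkQ_apply_self_eq_zero [CharZero k] {D : Der i} {a : A} {x : Omega i}
    (hD : contrDR i D ((superComm i).mkQ x) = (superComm i).mkQ (dgen i a)) :
    (comm k A).mkQ (D.1 a) = 0 := by
  rw [contrDR_mkQ, mkQ_eq_mkQ_iff] at hD
  -- Contracting `i_D x - da` once more leaves only `-D(a)`, a form of degree zero.
  have e1 := Submodule.mem_comap.1 (projZero_superComm i (contrDer_mem_superComm D hD))
  rw [map_sub, contrDer_contrDer_self, contrDer_dgen, zero_sub,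
    AlgHom.toLinearMap_apply, map_neg, projZero_incl, neg_mem_iff] at e1
  exact (mkQ_eq_zero_iff _).2 e1

lemma poisson_self [CharZero k] (h : IsBiSymplectic i ω) (p : CommQuot k A) :
    poisson h p p = 0 := by
  obtain ⟨a, rfl⟩ := (comm k A).mkQ_surjective p
  have ha := contrDR_theta h a
  obtain ⟨x, hx⟩ := (superComm i).mkQ_surjective ω.1
  rw [← hx] at ha
  rw [poisson_mk]
  exact mkQ_apply_self_eq_zero ha

lemma lie_der_apply (D E : Der i) (a : A) : ⁅D, E⁆.1 a = D.1 (E.1 a) - E.1 (D.1 a) := rfl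

lemma poisson_skew [CharZero k] (h : IsBiSymplectic i ω) (p q : CommQuot k A) :
    poisson h p q = -poisson h q p := by
  have := poisson_self h (p + q)
  simp only [map_add, LinearMap.add_apply, poisson_self, zero_add, add_zero] at this
  exact eq_neg_of_add_eq_zero_right this

lemma poisson_isLieBracket [CharZero k] (h : IsBiSymplectic i ω) : IsLieBracket (poisson h) := by
  refine ⟨poisson_self h, fun p q r => ?_⟩
  -- That `θ` intertwines the brackets, evaluated on `r`, is the Leibniz form of the Jacobi
  -- identity.
  have key : poisson h (poisson h p q) r =
      poisson h p (poisson h q r) - poisson h q (poisson h p r) := by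
    obtain ⟨c, rfl⟩ := (comm k A).mkQ_surjective r
    rw [poisson_mk, theta_poisson, lie_der_apply, map_sub]
    rfl
  rw [poisson_skew h r (poisson h p q), poisson_skew h r p, map_neg, key]
  abel

/-! ### Reduction by the moment element -/

variable {e : R ⊗[k] R} {he : IsSymmSep e} {w : A}

lemma Delta_apply (he : IsSymmSep e) (a : A) :
    (Delta i he).1 a = (a ⊗ₜ[k] (1 : A)) * Algebra.TensorProduct.map i i e
      - Algebra.TensorProduct.map i i e * ((1 : A) ⊗ₜ[k] a) := rfl

lemma redContr_Delta_dgen [CharZero k] (a : A) :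
    redContr i (Delta i he) (dgen i a) = 0 := by
  rw [redContr_apply, contr_dgen, Delta_apply, map_sub, map_sub, sub_eq_zero]
  induction Algebra.TensorProduct.map i i e using TensorProduct.induction_on with
  | zero => simp only [mul_zero, zero_mul]
  | add S T hS hT => simp only [mul_add, add_mul, map_add, hS, hT]
  -- Both terms become `y a x`: the factor `a` ends up in the middle from either side.
  | tmul x y => simp [diamond_tmul, mul_assoc]

/-- Hamiltonian derivations annihilate the moment element. -/
lemma theta_moment [CharZero k] (h : IsBiSymplectic i ω) (hw : IsMomentElement i he ω w)
    (p : CommQuot k A) : (theta h p).1 w = 0 := by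
  obtain ⟨a, rfl⟩ := (comm k A).mkQ_surjective p
  refine incl_injective i ?_
  rw [← contrDer_dgen, hw, contrDer_iota, contrDR_theta, map_zero, neg_eq_zero]
  exact redContr_Delta_dgen a

lemma idealOf_induction {C : A → Prop} {w : A} (h0 : C 0) (hadd : ∀ x y, C x → C y → C (x + y))
    (hmul : ∀ a b, C (a * w * b)) {x : A} (hx : x ∈ idealOf w) : C x := by
  refine AddSubgroup.closure_induction'' (p := fun x _ => C x) ?_ ?_ h0
    (fun x y _ _ hx hy => hadd x y hx hy)
    (TwoSidedIdeal.mem_span_iff_mem_addSubgroup_closure.1 (TwoSidedIdeal.mem_asIdeal.1 hx))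
  · rintro _ ⟨_, ⟨a, -, _, rfl, rfl⟩, b, -, rfl⟩
    exact hmul a b
  · rintro _ ⟨_, ⟨a, -, _, rfl, rfl⟩, b, -, rfl⟩
    -- The additive closure also allows negatives of generators; the sign is absorbed into the left
    -- coefficient.
    simpa using hmul (-a) b

lemma mul_mul_mem_idealOf (a w b : A) : a * w * b ∈ idealOf w := by
  have h : w ∈ idealOf w := TwoSidedIdeal.mem_asIdeal.2 (TwoSidedIdeal.subset_span rfl)
  exact (idealOf w).mul_mem_right b ((idealOf w).mul_mem_left a h)

/-- Since `D` kills `w`, it only differentiates the outer factors of `a w b`. -/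
lemma der_mem_idealOf {D : Der i} (hD : D.1 w = 0) {a : A} (ha : a ∈ idealOf w) :
    D.1 a ∈ idealOf w := by
  refine idealOf_induction (C := fun a => D.1 a ∈ idealOf w) ?_ (fun x y hx hy => ?_)
    (fun a b => ?_) ha
  · rw [map_zero]; exact zero_mem _
  · rw [map_add]; exact add_mem hx hy
  · rw [D.2.1, D.2.1, hD, mul_zero, add_zero]
    exact add_mem (mul_mul_mem_idealOf _ _ _) (mul_mul_mem_idealOf _ _ _)

/-- For `c ∈ A`, the derivation `θ_{cw}` is inner modulo the ideal `A w A`. -/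
lemma theta_mul_moment (h : IsBiSymplectic i ω) (hw : IsMomentElement i he ω w) (c : A) :
    ∃ m : A, (∀ r, i r * m = m * i r) ∧
      ∀ a, (theta h ((comm k A).mkQ (c * w))).1 a - (a * m - m * a) ∈ idealOf w := by
  obtain ⟨Ψ, hΨ⟩ := exists_iota_eq_dgen h c
  -- Leibniz for `d(cw)` combined with bimodule linearity of `ı(ω)`: the `Ψ` term supplies `dc · w`,
  -- the `Δ` term supplies `c · dw`.
  have hΘ : (iota i ω (DDer.act i 1 w Ψ + DDer.act i c 1 (Delta i he)) : Omega i) =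
      dgen i (c * w) := by
    rw [map_add (iota i ω), Submodule.coe_add, iota_act, iota_act, hΨ, ← hw, map_one, one_mul, mul_one, dgen_mul]
  rw [theta_mk_eq_mStar h hΘ]
  let E := Algebra.TensorProduct.map i i e
  have hE : ∀ r, (i r ⊗ₜ[k] (1 : A)) * E = E * ((1 : A) ⊗ₜ[k] i r) := fun r => by
    simpa using congrArg (Algebra.TensorProduct.map i i) (he.central r)
  -- Here `μ (x ⊗ y) = x c y`; it is linear for the outer bimodule structure.
  let μ : A ⊗[k] A →ₗ[k] A := LinearMap.mul' k A ∘ₗ inner c 1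
  have hl : ∀ (a : A) (T : A ⊗[k] A), μ ((a ⊗ₜ 1) * T) = a * μ T := fun a T => by
    induction T using TensorProduct.induction_on with
    | zero => simp only [mul_zero, map_zero]
    | add S T hS hT => simp only [mul_add, map_add, hS, hT]
    | tmul x y => simp [μ, mul_assoc]
  have hr : ∀ (a : A) (T : A ⊗[k] A), μ (T * (1 ⊗ₜ a)) = μ T * a := fun a T => by
    induction T using TensorProduct.induction_on with
    | zero => simp only [zero_mul, map_zero]
    | add S T hS hT => simp only [add_mul, map_add, hS, hT]
    | tmul x y => simp [μ, mul_assoc]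
  -- The witness is `m = e' c e''`; it commutes with `R` because `e` is central for the outer
  -- structure.
  refine ⟨μ E, fun r => by rw [← hl, hE, hr], fun a => ?_⟩
  have e1 : (mStar i (DDer.act i 1 w Ψ + DDer.act i c 1 (Delta i he))).1 a =
      LinearMap.mul' k A (inner 1 w (Ψ.1 a)) + μ ((Delta i he).1 a) := by
    rw [map_add]; rfl
  -- The `Δ` contribution is exactly `a m - m a`, so only `Ψ'(a) w Ψ''(a)` remains.
  rw [e1, Delta_apply, map_sub, hl, hr, add_sub_cancel_right]
  induction Ψ.1 a using TensorProduct.induction_on with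
  | zero => simp only [map_zero]; exact zero_mem _
  | add S T hS hT => simp only [map_add]; exact add_mem hS hT
  | tmul x y => simpa using mul_mul_mem_idealOf x w y

/-- Every class of `A w A` in `A_♮` is represented by an element of `A w`. -/
lemma exists_sub_mul_mem_comm {a : A} (ha : a ∈ idealOf w) : ∃ c : A, a - c * w ∈ comm k A := by
  refine idealOf_induction (C := fun a => ∃ c : A, a - c * w ∈ comm k A) ⟨0, by simp⟩ ?_
    (fun a b => ?_) ha
  · rintro x y ⟨c, hc⟩ ⟨d, hd⟩
    refine ⟨c + d, ?_⟩
    convert add_mem hc hd using 1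
    noncomm_ring
  -- Cyclic rotation: `a w b - b a w` is the commutator of `a w` and `b`.
  · exact ⟨b * a, Submodule.subset_span ⟨a * w, b, by noncomm_ring⟩⟩

/-! ### Descent along surjections. -/

lemma redMk_surjective (w : A) : Function.Surjective (redMk k w) := Ideal.Quotient.mk_surjective

lemma redMk_eq_zero_iff {a : A} : redMk k w a = 0 ↔ a ∈ idealOf w := Ideal.Quotient.eq_zero_iff_mem

lemma natMap_mk (f : A →ₐ[k] B) (a : A) :
    natMap f ((comm k A).mkQ a) = (comm k B).mkQ (f a) := rfl

lemma natMap_surjective {f : A →ₐ[k] B} (hf : Function.Surjective f) :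
    Function.Surjective (natMap f) := by
  intro y
  obtain ⟨b, rfl⟩ := (comm k B).mkQ_surjective y
  obtain ⟨a, rfl⟩ := hf b
  exact ⟨(comm k A).mkQ a, rfl⟩

/-- The kernel of `A_♮ → B_♮` comes from the kernel of `A → B`. -/
lemma exists_of_natMap_eq_zero {f : A →ₐ[k] B} (hf : Function.Surjective f) {p : CommQuot k A}
    (hp : natMap f p = 0) : ∃ a, f a = 0 ∧ (comm k A).mkQ a = p := by
  obtain ⟨a, rfl⟩ := (comm k A).mkQ_surjective p
  -- Commutators of `B` lift to commutators of `A`, so a lift of `p` can be corrected to lie in the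
  -- kernel of `f`.
  have hc : comm k B ≤ (comm k A).map f.toLinearMap := by
    refine Submodule.span_le.2 ?_
    rintro _ ⟨x, y, rfl⟩
    obtain ⟨x, rfl⟩ := hf x
    obtain ⟨y, rfl⟩ := hf y
    exact ⟨x * y - y * x, Submodule.subset_span ⟨x, y, rfl⟩, by simp⟩
  obtain ⟨c, hc, hca⟩ := hc ((Submodule.Quotient.mk_eq_zero _).1 hp)
  refine ⟨a - c, by rw [map_sub, sub_eq_zero]; exact hca.symm, ?_⟩
  rw [map_sub, sub_eq_self]
  exact (Submodule.Quotient.mk_eq_zero _).2 hc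

lemma exists_linearMap_of_ker_le {U V W : Type*} [AddCommGroup U] [Module k U] [AddCommGroup V]
    [Module k V] [AddCommGroup W] [Module k W] {f : V →ₗ[k] W} (hf : Function.Surjective f)
    (g : V →ₗ[k] U) (hg : ∀ v, f v = 0 → g v = 0) : ∃ g' : W →ₗ[k] U, ∀ v, g' (f v) = g v :=
  ⟨(LinearMap.ker f).liftQ g hg ∘ₗ (f.quotKerEquivOfSurjective hf).symm.toLinearMap, fun v => by
    have : (f.quotKerEquivOfSurjective hf).symm (f v) = (LinearMap.ker f).mkQ v := by
      rw [LinearEquiv.symm_apply_eq]; rfl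
    rw [LinearMap.comp_apply, LinearEquiv.coe_coe, this]; rfl⟩

/-- Each variable is descended separately, with a flip in between. -/
lemma exists_bilinear_of_ker_le {U V W : Type*} [AddCommGroup U] [Module k U] [AddCommGroup V]
    [Module k V] [AddCommGroup W] [Module k W] {f : V →ₗ[k] W} (hf : Function.Surjective f)
    (g : V →ₗ[k] V →ₗ[k] U) (hl : ∀ v v', f v = 0 → g v v' = 0)
    (hr : ∀ v v', f v' = 0 → g v v' = 0) :
    ∃ g' : W →ₗ[k] W →ₗ[k] U, ∀ v v', g' (f v) (f v') = g v v' := by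
  obtain ⟨g₁, h₁⟩ := exists_linearMap_of_ker_le hf g fun v hv => LinearMap.ext fun v' => hl v v' hv
  obtain ⟨g₂, h₂⟩ := exists_linearMap_of_ker_le hf g₁.flip fun v' hv' => by
    refine LinearMap.ext fun y => ?_
    obtain ⟨v, rfl⟩ := hf y
    rw [LinearMap.flip_apply, h₁]
    exact hr v v' hv'
  exact ⟨g₂.flip, fun v v' => by rw [LinearMap.flip_apply, h₂, LinearMap.flip_apply, h₁]⟩

/-- The inclusion of derivations in linear endomorphisms. -/
def derToEnd (i : R →ₐ[k] A) : Der i →ₗ[k] A →ₗ[k] A where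
  toFun D := D.1
  map_add' _ _ := rfl
  map_smul' _ _ := rfl

/-- A linear family of derivations that preserve `A w A` induces one on `A_w`. -/
lemma exists_redDer {V : Type*} [AddCommGroup V] [Module k V] (t : V →ₗ[k] Der i)
    (ht : ∀ v, ∀ a ∈ idealOf w, (t v).1 a ∈ idealOf w) :
    ∃ s : V →ₗ[k] Der (redBase i w), ∀ v a, (s v).1 (redMk k w a) = redMk k w ((t v).1 a) := by
  -- Descending the whole family as one map `A → Hom(V, A_w)` makes linearity in `v` automatic.
  let g : A →ₗ[k] V →ₗ[k] Red w := ((redMk k w).toLinearMap.compRight k ∘ₗ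
    derToEnd i ∘ₗ t).flip
  have hg : ∀ a v, g a v = redMk k w ((t v).1 a) := fun _ _ => rfl
  obtain ⟨g', h'⟩ := exists_linearMap_of_ker_le (f := (redMk k w).toLinearMap)
    (redMk_surjective (k := k) w) g fun a ha => LinearMap.ext fun v => by
      rw [hg]
      exact redMk_eq_zero_iff.2 (ht v a ((redMk_eq_zero_iff (k := k)).1 ha))
  have hs : ∀ v a, g'.flip v (redMk k w a) = redMk k w ((t v).1 a) := fun v a => by
    rw [← hg, ← h']; rfl
  refine ⟨{ toFun := fun v => ⟨g'.flip v, fun x y => ?_, fun r => ?_⟩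
            map_add' := fun u v => Subtype.ext (map_add g'.flip u v)
            map_smul' := fun c v => Subtype.ext (map_smul g'.flip c v) }, hs⟩
  · obtain ⟨a, rfl⟩ := redMk_surjective (k := k) w x
    obtain ⟨b, rfl⟩ := redMk_surjective (k := k) w y
    rw [← map_mul, hs, hs, hs, (t v).2.1, map_add, map_mul, map_mul]
  · refine (hs v (i r)).trans ?_
    rw [(t v).2.2 r, map_zero]

end hamiltonian

end NCSymp
end

/-! ### Hamiltonian reduction of the bracket and the map to outer derivations. -/

theorem proposition4p12 {k R A : Type*} [Field k] [CharZero k]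
    [Ring R] [Algebra k R] [FiniteDimensional k R] [IsSemisimpleRing R]
    [Ring A] [Algebra k A] (i : R →ₐ[k] A) (hi : Function.Injective i)
    {e : R ⊗[k] R} (he : NCSymp.IsSymmSep e)
    (ω : NCSymp.DR.deg i 2) (hω : NCSymp.IsBiSymplectic i ω)
    (w : A) (hw : NCSymp.IsMomentElement i he ω w) :
    NCSymp.IsLieBracket (NCSymp.poisson hω) ∧
    (∀ p : NCSymp.CommQuot k A, ∀ a ∈ NCSymp.idealOf w,
      (NCSymp.theta hω p).1 a ∈ NCSymp.idealOf w) ∧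
    ∃ θbar : NCSymp.CommQuot k A →ₗ[k] NCSymp.Der (NCSymp.redBase i w),
      (∀ (p : NCSymp.CommQuot k A) (a : A),
        (θbar p).1 (NCSymp.redMk k w a) = NCSymp.redMk k w ((NCSymp.theta hω p).1 a)) ∧
      ∃ b : NCSymp.CommQuot k (NCSymp.Red w) →ₗ[k] NCSymp.CommQuot k (NCSymp.Red w) →ₗ[k]
          NCSymp.CommQuot k (NCSymp.Red w),
        NCSymp.IsLieBracket b ∧
        (∀ p q : NCSymp.CommQuot k A,
          b (NCSymp.natMap (NCSymp.redMk k w) p) (NCSymp.natMap (NCSymp.redMk k w) q) =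
            NCSymp.natMap (NCSymp.redMk k w) (NCSymp.poisson hω p q)) ∧
        ∃ φ : NCSymp.CommQuot k (NCSymp.Red w) →ₗ[k]
            (NCSymp.Der (NCSymp.redBase i w) ⧸ NCSymp.Inn (NCSymp.redBase i w)),
          (∀ x y, φ (b x y) = ⁅φ x, φ y⁆) ∧
          ∀ p : NCSymp.CommQuot k A, φ (NCSymp.natMap (NCSymp.redMk k w) p) =
            LieSubmodule.Quotient.mk (θbar p) := by
  have hpres : ∀ p : NCSymp.CommQuot k A, ∀ a ∈ NCSymp.idealOf w,
      (NCSymp.theta hω p).1 a ∈ NCSymp.idealOf w := fun p a ha =>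
    NCSymp.der_mem_idealOf (NCSymp.theta_moment hω hw p) ha
  have hsurj := NCSymp.natMap_surjective (NCSymp.redMk_surjective (k := k) w)
  have hLie := NCSymp.poisson_isLieBracket hω
  obtain ⟨θbar, hθ⟩ := NCSymp.exists_redDer (NCSymp.theta hω) hpres
  have hr : ∀ p q, NCSymp.natMap (NCSymp.redMk k w) q = 0 →
      NCSymp.natMap (NCSymp.redMk k w) (NCSymp.poisson hω p q) = 0 := fun p q hq => by
    obtain ⟨a, ha, rfl⟩ := NCSymp.exists_of_natMap_eq_zero (NCSymp.redMk_surjective w) hq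
    rw [NCSymp.poisson_mk, NCSymp.natMap_mk,
      NCSymp.redMk_eq_zero_iff.2 (hpres p a (NCSymp.redMk_eq_zero_iff.1 ha)), map_zero]
  obtain ⟨b, hb⟩ := NCSymp.exists_bilinear_of_ker_le hsurj
    ((NCSymp.natMap (NCSymp.redMk k w)).compRight k ∘ₗ NCSymp.poisson hω)
    (fun p q hp => by
      change NCSymp.natMap (NCSymp.redMk k w) (NCSymp.poisson hω p q) = 0
      rw [NCSymp.poisson_skew, map_neg, hr q p hp, neg_zero]) hr
  replace hb : ∀ p q : NCSymp.CommQuot k A,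
      b (NCSymp.natMap (NCSymp.redMk k w) p) (NCSymp.natMap (NCSymp.redMk k w) q) =
        NCSymp.natMap (NCSymp.redMk k w) (NCSymp.poisson hω p q) := hb
  let π : NCSymp.Der (NCSymp.redBase i w) →ₗ[k]
      NCSymp.Der (NCSymp.redBase i w) ⧸ NCSymp.Inn (NCSymp.redBase i w) :=
    (NCSymp.Inn (NCSymp.redBase i w)).toSubmodule.mkQ
  -- The map `p ↦ [θbar p]` must vanish on the kernel of `A_♮ → (A_w)_♮`. A kernel class is
  -- represented by some `c w`, whose derivation becomes inner modulo `AwA`.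
  obtain ⟨φ, hφ⟩ := NCSymp.exists_linearMap_of_ker_le hsurj (π ∘ₗ θbar) fun p hp => by
    obtain ⟨a, ha, rfl⟩ := NCSymp.exists_of_natMap_eq_zero (NCSymp.redMk_surjective w) hp
    obtain ⟨c, hc⟩ := NCSymp.exists_sub_mul_mem_comm (k := k) (NCSymp.redMk_eq_zero_iff.1 ha)
    rw [show (NCSymp.comm k A).mkQ a = (NCSymp.comm k A).mkQ (c * w) from
      (Submodule.Quotient.eq _).2 hc]
    obtain ⟨m, hm, hin⟩ := NCSymp.theta_mul_moment hω hw c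
    refine (Submodule.Quotient.mk_eq_zero _).2 ⟨NCSymp.redMk k w m, fun r => ?_, fun x => ?_⟩
    · change NCSymp.redMk k w (i r) * _ = _ * NCSymp.redMk k w (i r)
      rw [← map_mul, ← map_mul, hm]
    · obtain ⟨x, rfl⟩ := NCSymp.redMk_surjective (k := k) w x
      rw [hθ, ← map_mul, ← map_mul, ← map_sub, ← sub_eq_zero, ← map_sub]
      exact NCSymp.redMk_eq_zero_iff.2 (hin x)
  refine ⟨hLie, hpres, θbar, hθ, b, ⟨fun x => ?_, fun x y z => ?_⟩, hb, φ, fun x y => ?_, hφ⟩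
  · obtain ⟨p, rfl⟩ := hsurj x
    rw [hb, hLie.alt, map_zero]
  · obtain ⟨p, rfl⟩ := hsurj x
    obtain ⟨q, rfl⟩ := hsurj y
    obtain ⟨r, rfl⟩ := hsurj z
    simp only [hb]
    rw [← map_add, ← map_add, hLie.jacobi, map_zero]
  · obtain ⟨p, rfl⟩ := hsurj x
    obtain ⟨q, rfl⟩ := hsurj y
    -- The bracket identity already holds among derivations of `A_w`, before inner ones are divided
    -- out.
    have key : θbar (NCSymp.poisson hω p q) = ⁅θbar p, θbar q⁆ := by
      refine Subtype.ext (LinearMap.ext fun x => ?_)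
      obtain ⟨a, rfl⟩ := NCSymp.redMk_surjective (k := k) w x
      rw [hθ, NCSymp.lie_der_apply, hθ, hθ, hθ, hθ, NCSymp.theta_poisson, NCSymp.lie_der_apply,
        map_sub]
    rw [hb, hφ, hφ, hφ]
    exact (congrArg π key).trans (LieSubmodule.Quotient.mk_bracket _ _ _)
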